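/- Call a measurable function $U:[0,\infty)^2\to[0,\infty)$ a $\theta$-regular kernel ($\theta>0$) if $U(x,y)$ is nonincreasing in $x$ and nondecreasing in $y$, $U(x,z)\le\theta\,(U(x,y)+U(y,z))$ for all $0\le x<y<z<\infty$, and $U(0,y)>0$ for all $y>0$. A weight is a nonnegative measurable function $w$ on $(0,\infty)$ with $0<\int_0^t w(s)\,ds<\infty$ for all $t>0$. Measurable means Lebesgue measurable. Let $0<q<1$, $q'=\frac{q}{q-1}$ and $0<\theta<\infty$. Let $v,w$ be weights and let $U$ be a $\theta$-regular kernel. With the conventions $0\cdot\infty=0$ and $0^{q'}=\infty$, put $$A_3^*=\int_0^\infty\Big(\int_t^\infty w(x)\,dx\Big)^{-q'}w(t)\ \operatorname*{ess\,sup}_{z\in(0,t)}U^{-q'}(z,t)\,v^{q'}(z)\,dt,$$ $$A_4^*=\int_0^\infty\Big(\int_t^\infty w(x)\,U^q(t,x)\,dx\Big)^{-q'}w(t)\ \operatorname*{ess\,sup}_{z\in(0,t)}U^{q}(z,t)\,v^{q'}(z)\,dt.$$ Then the following are equivalent: (i) there is a constant $C\in(0,\infty)$ such that $$\Big(\int_0^\infty\Big(\int_0^t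 f(x)\,U(x,t)\,dx\Big)^q w(t)\,dt\Big)^{1/q}\le C\int_0^\infty f(t)\,v(t)\,dt$$ for all nonnegative measurable functions $f$ on $(0,\infty)$; (ii) $A_3^*<\infty$ and $A_4^*<\infty$. Moreover, if $C\in[0,\infty]$ is the optimal (infimal) constant in this inequality ($C=\infty$ if no finite constant works), then $C^{-q'}\approx A_3^*+A_4^*$, that is, $K^{-1}(A_3^*+A_4^*)\le C^{-q'}\le K\,(A_3^*+A_4^*)$ with a constant $K\in(0,\infty)$ depending only on $q$ and $\theta$. -/

import Mathlib

open MeasureTheory Set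
open scoped NNReal ENNReal

/-- A `θ`-regular kernel `U : [0,∞)² → [0,∞)`; only the values on `[0,∞)²` matter.
Measurability is Lebesgue measurability. -/
structure IsRegularKernel (θ : ℝ≥0) (U : ℝ → ℝ → ℝ≥0) : Prop where
  measurable : AEMeasurable (fun p : ℝ × ℝ => U p.1 p.2)
    (volume.restrict (Ici (0 : ℝ) ×ˢ Ici (0 : ℝ)))
  antitone_left : ∀ y, 0 ≤ y → AntitoneOn (fun x => U x y) (Ici 0)
  monotone_right : ∀ x, 0 ≤ x → MonotoneOn (fun y => U x y) (Ici 0)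
  triangle : ∀ x y z, 0 ≤ x → x < y → y < z → U x z ≤ θ * (U x y + U y z)
  pos : ∀ y, 0 < y → 0 < U 0 y

/-- The cone of nonnegative Lebesgue measurable functions on `(0,∞)`; only the values
on `(0,∞)` matter. -/
def NonnegMeasurable (f : ℝ → ℝ≥0∞) : Prop :=
  AEMeasurable f (volume.restrict (Ioi (0 : ℝ)))

/-- A weight on `(0,∞)`. -/
def IsWeight (w : ℝ → ℝ≥0∞) : Prop :=
  NonnegMeasurable w ∧
    ∀ t : ℝ, 0 < t → 0 < ∫⁻ s in Ioo 0 t, w s ∧ ∫⁻ s in Ioo 0 t, w s < ∞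

/-- The (quasi-)norm of a nonnegative function in `L^p(v)` on `(0,∞)`, for `0 < p < ∞`. -/
noncomputable def weightedNorm (p : ℝ) (v f : ℝ → ℝ≥0∞) : ℝ≥0∞ :=
  (∫⁻ t in Ioi 0, f t ^ p * v t) ^ (1 / p)

/-- The Hardy-type operator `H f (t) = ∫₀ᵗ f(x) U(x,t) dx`. -/
noncomputable def hardyOp (U : ℝ → ℝ → ℝ≥0) (f : ℝ → ℝ≥0∞) (t : ℝ) : ℝ≥0∞ :=
  ∫⁻ x in Ioo 0 t, f x * U x t

/-- `‖H f‖_{L^q(w)} ≤ C ‖f‖_{L^p(v)}` for all nonnegative measurable `f`. -/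
def HardyInequality (p q : ℝ) (U : ℝ → ℝ → ℝ≥0) (v w : ℝ → ℝ≥0∞) (C : ℝ≥0) : Prop :=
  ∀ f : ℝ → ℝ≥0∞, NonnegMeasurable f →
    weightedNorm q w (hardyOp U f) ≤ C * weightedNorm p v f

/-- The least constant in the inequality, equal to `∞` if no finite constant is admissible. -/
noncomputable def hardyConst (p q : ℝ) (U : ℝ → ℝ → ℝ≥0) (v w : ℝ → ℝ≥0∞) : ℝ≥0∞ :=
  ⨅ (C : ℝ≥0) (_ : HardyInequality p q U v w C), (C : ℝ≥0∞)

/-- The conjugate exponent `q' = q / (q - 1)`, negative for `0 < q < 1`. -/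
noncomputable def conjExp (q : ℝ) : ℝ := q / (q - 1)

/-- The condition `A₃*`. In `ℝ≥0∞`, `0 * ∞ = 0`, and `0 ^ a = ∞` for `a < 0`. -/
noncomputable def A3star (q : ℝ) (U : ℝ → ℝ → ℝ≥0) (v w : ℝ → ℝ≥0∞) : ℝ≥0∞ :=
  ∫⁻ t in Ioi (0 : ℝ), (∫⁻ x in Ioi t, w x) ^ (-conjExp q) * w t *
    essSup (fun z => (U z t : ℝ≥0∞) ^ (-conjExp q) * v z ^ conjExp q)
      (volume.restrict (Ioo 0 t))

/-- The condition `A₄*`. -/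
noncomputable def A4star (q : ℝ) (U : ℝ → ℝ → ℝ≥0) (v w : ℝ → ℝ≥0∞) : ℝ≥0∞ :=
  ∫⁻ t in Ioi (0 : ℝ), (∫⁻ x in Ioi t, w x * (U t x : ℝ≥0∞) ^ q) ^ (-conjExp q) * w t *
    essSup (fun z => (U z t : ℝ≥0∞) ^ q * v z ^ conjExp q)
      (volume.restrict (Ioo 0 t))

/-! Write r = -q' = q/(1-q), dν = w dt, V(s) = ∫_{(s,∞)} U(s,u)^q dν(u), and let S(t), R(t) be the
essential suprema over z < t of U(z,t)^r v(z)^{-r} and U(z,t)^q v(z)^{-r}. Then A₃* + A₄* is the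
ν-integral of N = ν(t,∞)^r S + V^r R, and it has to be compared with C^r.

Sufficiency is a duality argument. For a weight G > 0 with finite integral, Hölder's inequality
gives ∫ (Hf)^q dν ≤ (∫ Hf · G^{-1/r} dν)^q (∫ G dν)^{1-q}. By Tonelli the first factor is controlled
by ∫ f v once ∫_{(x,∞)} U(x,t) G(t)^{-1/r} dν(t) ≲ v(x), and this follows from the pointwise bound
v(x)^{-r} U(x,t)^q V(x)^r ≲ G(t) for x < t (`lintegral_kernel_mul_le`). N does not account for the
mass that V(x) sees between x and t. Adding to N the integral over s < t of N(s)/ν(s,∞) + N(s)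
U(s,t)^q / V(s) repairs this (`rpow_mul_kernelTail_le_auxWeight`), and the total integral is at most
tripled (`lintegral_auxWeight_le`).

Necessity is a discretization. Along points t_k where ν(t_k,∞) decays geometrically, superpositions
of near-extremal functions reduce the inequality to discrete Hardy inequalities, whose necessary
condition is `tsum_le_of_discrete_hardy`. One reduction, with the kernel kept, bounds ∑
ν(t_k,∞)^{1+r} S(t_k); another, with the kernel frozen to U(t_k,t_{k+1}), bounds sums with weights
g_k = ν(t_k,∞) U(t_k,t_{k+1})^q and suprema of v^{-r} alone. The remaining terms ν(t_k,∞) V(t_k)^r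
R(t_k) satisfy a recursion with factor 1/2 whose sources are sums of these two kinds
(`stepTerm_succ_le`); the ratio of the tails is taken large in terms of θ to obtain that factor. -/

/-! ### Sequences in [0,∞]: contractions, tail sums, power rules -/

theorem ENNReal.add_rpow_le_two_rpow_mul {r : ℝ} (hr : 0 ≤ r) (a b : ℝ≥0∞) :
    (a + b) ^ r ≤ 2 ^ r * (a ^ r + b ^ r) := by
  have h : a + b ≤ 2 * max a b := by
    rw [two_mul]; exact add_le_add (le_max_left _ _) (le_max_right _ _)
  calc (a + b) ^ r ≤ (2 * max a b) ^ r := ENNReal.rpow_le_rpow h hr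
    _ = 2 ^ r * (max a b) ^ r := ENNReal.mul_rpow_of_nonneg _ _ hr
    _ ≤ 2 ^ r * (a ^ r + b ^ r) := by
        gcongr
        rcases le_total a b with h | h
        · rw [max_eq_right h]; exact le_add_self
        · rw [max_eq_left h]; exact le_self_add

/-- The extra summand `Y n` closes the induction: the doubled hypothesis pays for two copies of `Y
(n + 1)` with one copy of `Y n`, so nothing has to be subtracted in [0,∞]. -/
theorem sum_range_add_last_le_of_contracting {Y h : ℕ → ℝ≥0∞}
    (hY : ∀ k, Y (k + 1) ≤ 2⁻¹ * Y k + h k) (n : ℕ) :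
    ∑ k ∈ Finset.range (n + 1), Y k + Y n ≤ 2 * Y 0 + 2 * ∑ k ∈ Finset.range n, h k := by
  induction n with
  | zero => simp [two_mul]
  | succ n ih =>
    rw [Finset.sum_range_succ, Finset.sum_range_succ (fun k => h k), mul_add]
    have h2 : 2 * Y (n + 1) ≤ Y n + 2 * h n := by
      calc 2 * Y (n + 1) ≤ 2 * (2⁻¹ * Y n + h n) := by gcongr; exact hY n
        _ = Y n + 2 * h n := by
          rw [mul_add, ← mul_assoc, ENNReal.mul_inv_cancel (by simp) (by simp), one_mul]
    calc _ = ∑ k ∈ Finset.range (n + 1), Y k + 2 * Y (n + 1) := by ring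
      _ ≤ ∑ k ∈ Finset.range (n + 1), Y k + (Y n + 2 * h n) := by gcongr
      _ = (∑ k ∈ Finset.range (n + 1), Y k + Y n) + 2 * h n := by ring
      _ ≤ _ := by
        rw [← add_assoc]; gcongr

theorem tsum_le_of_contracting {Y h : ℕ → ℝ≥0∞}
    (hY : ∀ k, Y (k + 1) ≤ 2⁻¹ * Y k + h k) (h0 : Y 0 = 0) :
    ∑' k, Y k ≤ 2 * ∑' k, h k := by
  rw [ENNReal.tsum_eq_iSup_nat]
  refine iSup_le fun n => ?_
  have := sum_range_add_last_le_of_contracting hY n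
  rw [h0, mul_zero, zero_add, Finset.sum_range_succ] at this
  calc ∑ k ∈ Finset.range n, Y k ≤ 2 * ∑ k ∈ Finset.range n, h k :=
        le_trans (le_trans le_self_add le_self_add) this
    _ ≤ _ := by gcongr; exact ENNReal.sum_le_tsum _

/-- The tail sum `∑_{i ≥ j} g i`. -/
noncomputable def tailSum (g : ℕ → ℝ≥0∞) (j : ℕ) : ℝ≥0∞ := ∑' i, if j ≤ i then g i else 0

theorem tailSum_antitone (g : ℕ → ℝ≥0∞) : Antitone (tailSum g) := by
  intro i j hij
  refine ENNReal.tsum_le_tsum fun k => ?_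
  by_cases h : j ≤ k
  · simp [h, hij.trans h]
  · simp [h]

theorem le_tailSum (g : ℕ → ℝ≥0∞) (j : ℕ) : g j ≤ tailSum g j := by
  have := ENNReal.le_tsum (f := fun i => if j ≤ i then g i else 0) j
  simpa [tailSum] using this

/-- Summation by parts, as an exchange of the double sum over j ≤ i. -/
theorem tsum_mul_sum_range_succ (F d : ℕ → ℝ≥0∞) :
    ∑' i, F i * ∑ j ∈ Finset.range (i + 1), d j = ∑' j, d j * tailSum F j := by
  have : ∀ i, F i * ∑ j ∈ Finset.range (i + 1), d j = ∑' j, if j ≤ i then d j * F i else 0 := by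
    intro i
    rw [tsum_eq_sum (s := Finset.range (i + 1)) (fun j hj => by
      rw [if_neg]; simpa using hj), Finset.mul_sum]
    refine Finset.sum_congr rfl fun j hj => ?_
    rw [if_pos (by simpa [Nat.lt_succ_iff] using hj), mul_comm]
  simp_rw [this]
  rw [ENNReal.tsum_comm]
  refine tsum_congr fun j => ?_
  rw [tailSum, ← ENNReal.tsum_mul_left]
  refine tsum_congr fun i => ?_
  split_ifs <;> simp

theorem ENNReal.le_two_mul_of_le_add_half {x a : ℝ≥0∞} (hx : x ≠ ∞) (h : x ≤ a + x / 2) :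
    x ≤ 2 * a := by
  have h2 : x / 2 + x / 2 ≤ a + x / 2 := by rwa [ENNReal.add_halves]
  have h3 : x / 2 ≤ a := (ENNReal.add_le_add_iff_right (by
    exact ne_top_of_le_ne_top hx ENNReal.half_le_self)).1 h2
  calc x = 2 * (x / 2) := by rw [two_mul, ENNReal.add_halves]
    _ ≤ 2 * a := by gcongr

/-- Indices whose tail is below G/2 form a final segment and carry mass at most G/2. The others
carry at least half of G, and on them G is at most twice the local tail. -/
theorem tailSum_rpow_le {g : ℕ → ℝ≥0∞} {r : ℝ} (hr : 0 < r) {j : ℕ} (hj : tailSum g j ≠ ∞) :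
    tailSum g j ^ (1 + r) ≤ 2 ^ (1 + r) * tailSum (fun i => g i * tailSum g i ^ r) j := by
  set G := tailSum g j with hG
  have key : G ≤ 2 * ∑' i, if j ≤ i ∧ G / 2 ≤ tailSum g i then g i else 0 := by
    apply ENNReal.le_two_mul_of_le_add_half hj
    have hsplit : G = (∑' i, if j ≤ i ∧ G / 2 ≤ tailSum g i then g i else 0) +
        ∑' i, if j ≤ i ∧ tailSum g i < G / 2 then g i else 0 := by
      rw [← ENNReal.tsum_add, hG]
      unfold tailSum
      refine tsum_congr fun i => ?_
      by_cases h1 : j ≤ i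
      · rcases le_or_gt (G / 2) (tailSum g i) with h2 | h2
        · have h3 := not_lt.2 h2
          unfold tailSum at h2 h3 hG
          rw [hG] at h2 h3
          simp [h1, h2, h3]
        · have h3 := not_le.2 h2
          unfold tailSum at h2 h3 hG
          rw [hG] at h2 h3
          simp [h1, h2, h3]
      · simp [h1]
    conv_lhs => rw [hsplit]
    gcongr
    by_cases hex : ∃ i, j ≤ i ∧ tailSum g i < G / 2
    · classical
      have hm := Nat.find_spec hex
      refine le_trans ?_ hm.2.le
      refine ENNReal.tsum_le_tsum fun i => ?_
      by_cases h : j ≤ i ∧ tailSum g i < G / 2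
      · rw [if_pos h, if_pos (Nat.find_min' hex h)]
      · rw [if_neg h]; exact zero_le
    · push Not at hex
      have : ∀ i, (if j ≤ i ∧ tailSum g i < G / 2 then g i else 0) = 0 := fun i =>
        if_neg fun h => absurd h.2 (not_lt.2 (hex i h.1))
      simp [this]
  rw [ENNReal.rpow_add_of_nonneg _ _ zero_le_one hr.le, ENNReal.rpow_one]
  calc G * G ^ r ≤ (2 * ∑' i, if j ≤ i ∧ G / 2 ≤ tailSum g i then g i else 0) * G ^ r := by gcongr
    _ = 2 * ∑' i, (if j ≤ i ∧ G / 2 ≤ tailSum g i then g i else 0) * G ^ r := by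
        rw [mul_assoc, ENNReal.tsum_mul_right]
    _ ≤ 2 * ∑' i, 2 ^ r * (if j ≤ i then g i * tailSum g i ^ r else 0) := by
        refine mul_le_mul_right (ENNReal.tsum_le_tsum fun i => ?_) 2
        by_cases h : j ≤ i ∧ G / 2 ≤ tailSum g i
        · rw [if_pos h, if_pos h.1]
          have : G ≤ 2 * tailSum g i := by
            calc G = 2 * (G / 2) := by rw [two_mul, ENNReal.add_halves]
              _ ≤ _ := by gcongr; exact h.2
          calc g i * G ^ r ≤ g i * (2 * tailSum g i) ^ r := by gcongr
            _ = _ := by rw [ENNReal.mul_rpow_of_nonneg _ _ hr.le]; ring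
        · rw [if_neg h]; simp
    _ = 2 ^ (1 + r) * tailSum (fun i => g i * tailSum g i ^ r) j := by
        rw [ENNReal.tsum_mul_left, ENNReal.rpow_add_of_nonneg _ _ zero_le_one hr.le,
          ENNReal.rpow_one, mul_assoc]
        rfl

/-- Mirror image of `tailSum_rpow_le`: indices whose partial sum is below half of the last one carry
at most half of the mass. -/
theorem sum_range_rpow_le {d : ℕ → ℝ≥0∞} {s : ℝ} (hs : 0 < s) {i : ℕ}
    (hi : ∑ j ∈ Finset.range (i + 1), d j ≠ ∞) :
    (∑ j ∈ Finset.range (i + 1), d j) ^ (1 + s) ≤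
      2 ^ (1 + s) * ∑ j ∈ Finset.range (i + 1), d j * (∑ k ∈ Finset.range (j + 1), d k) ^ s := by
  set a : ℕ → ℝ≥0∞ := fun i => ∑ j ∈ Finset.range (i + 1), d j with ha
  change a i ≠ ∞ at hi
  change a i ^ (1 + s) ≤ 2 ^ (1 + s) * ∑ j ∈ Finset.range (i + 1), d j * a j ^ s
  have key : a i ≤ 2 * ∑ j ∈ (Finset.range (i + 1)).filter (fun j => a i / 2 ≤ a j), d j := by
    apply ENNReal.le_two_mul_of_le_add_half hi
    have hsplit := Finset.sum_filter_add_sum_filter_not (Finset.range (i + 1))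
      (fun j => a i / 2 ≤ a j) d
    conv_lhs => rw [ha]; simp only []; rw [← hsplit]
    gcongr
    set B := (Finset.range (i + 1)).filter (fun j => ¬ a i / 2 ≤ a j) with hB
    rcases B.eq_empty_or_nonempty with h | h
    · rw [h]; simp
    · have hm := Finset.mem_filter.1 (B.max'_mem h)
      refine le_trans (Finset.sum_le_sum_of_subset ?_) (not_le.1 hm.2).le
      intro k hk
      rw [Finset.mem_range, Nat.lt_succ_iff]
      exact B.le_max' k hk
  rw [ENNReal.rpow_add_of_nonneg _ _ zero_le_one hs.le, ENNReal.rpow_one]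
  calc a i * a i ^ s
      ≤ (2 * ∑ j ∈ (Finset.range (i + 1)).filter (fun j => a i / 2 ≤ a j), d j) * a i ^ s := by
        gcongr
    _ = 2 * ∑ j ∈ (Finset.range (i + 1)).filter (fun j => a i / 2 ≤ a j), d j * a i ^ s := by
        rw [mul_assoc, Finset.sum_mul]
    _ ≤ 2 * ∑ j ∈ (Finset.range (i + 1)).filter (fun j => a i / 2 ≤ a j),
          2 ^ s * (d j * a j ^ s) := by
        refine mul_le_mul_right (Finset.sum_le_sum fun j hj => ?_) 2
        have : a i ≤ 2 * a j := by
          calc a i = 2 * (a i / 2) := by rw [two_mul, ENNReal.add_halves]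
            _ ≤ _ := by gcongr; exact (Finset.mem_filter.1 hj).2
        calc d j * a i ^ s ≤ d j * (2 * a j) ^ s := by gcongr
          _ = _ := by rw [ENNReal.mul_rpow_of_nonneg _ _ hs.le]; ring
    _ ≤ 2 * ∑ j ∈ Finset.range (i + 1), 2 ^ s * (d j * a j ^ s) := by
        gcongr; exact Finset.filter_subset _ _
    _ = _ := by
        rw [← Finset.mul_sum, ENNReal.rpow_add_of_nonneg _ _ zero_le_one hs.le,
          ENNReal.rpow_one, mul_assoc]

/-! ### Necessary condition for the discrete Hardy inequality -/

/-- The last clause makes the increments of a finite, eventually constant sequence finitely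
supported. -/
theorem exists_eq_sum_range_succ {a : ℕ → ℝ≥0∞} (ha : Monotone a) :
    ∃ d : ℕ → ℝ≥0∞, (∀ i, a i = ∑ j ∈ Finset.range (i + 1), d j) ∧
      (∀ i, d i ≤ a i) ∧ ∀ i, a (i + 1) = a i → a i ≠ ∞ → d (i + 1) = 0 := by
  refine ⟨fun i => Nat.casesOn i (a 0) (fun i => a (i + 1) - a i), fun i => ?_, fun i => ?_,
    fun i h _ => ?_⟩
  · induction i with
    | zero => simp
    | succ i ih =>
      rw [Finset.sum_range_succ, ← ih]
      exact (add_tsub_cancel_of_le (ha (Nat.le_succ i))).symm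
  · cases i with
    | zero => exact le_rfl
    | succ i => exact tsub_le_self
  · change a (i + 1) - a i = 0
    rw [h]; simp

/-- The discrete Hardy inequality with `0 < q < 1` implies its integral-type condition. -/
theorem tsum_le_of_discrete_hardy {q r : ℝ} (hq0 : 0 < q) (hq1 : q < 1) (hr : r = q / (1 - q))
    {g σ : ℕ → ℝ≥0∞} (hσ : Monotone σ) {D : ℝ≥0∞} (hD : D ≠ ∞)
    (H : ∀ c a : ℕ → ℝ≥0∞, (∀ j, a j = 0 ∨ a j < σ j) →
      ∑' i, g i * (∑ j ∈ Finset.range (i + 1), c j * a j ^ (1 / r)) ^ q ≤ D * (∑' j, c j) ^ q)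
    {e : ℕ → ℝ≥0∞} (he : ∀ j, tailSum e j ≤ tailSum g j) :
    ∑' i, e i * tailSum g i ^ r * σ i ≤ 2 * (2 ^ (2 + r) * D) ^ (1 + r) := by
  have h1q : 0 < 1 - q := by linarith
  have hr0 : 0 < r := by rw [hr]; positivity
  have hqr : (1 + r) * q = r := by rw [hr]; field_simp; ring
  have hqs : (1 + 1 / r) * q = 1 := by rw [hr]; field_simp; ring
  have hrq : (1 - q) * (1 + r) = 1 := by rw [hr]; field_simp; ring
  set X := tailSum g with hX
  -- Testing with a unit mass at `j` bounds the tail at `j`.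
  have hXtop : ∀ j, σ j ≠ 0 → X j ≠ ∞ := by
    intro j hj
    obtain ⟨b, hb0, hb⟩ := exists_between (pos_iff_ne_zero.2 hj)
    have h1 := H (Pi.single j 1) (fun i => if i = j then b else 0) (fun i => by
      by_cases h : i = j
      · subst h; right; simpa using hb
      · left; simp [h])
    have h2 : ∑' i, (Pi.single j 1 : ℕ → ℝ≥0∞) i = 1 := by simp
    rw [h2, ENNReal.one_rpow, mul_one] at h1
    have h3 : X j * (b ^ (1 / r)) ^ q ≤ D := by
      refine le_trans ?_ h1
      rw [hX, tailSum, ← ENNReal.tsum_mul_right]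
      refine ENNReal.tsum_le_tsum fun i => ?_
      by_cases h : j ≤ i
      · rw [if_pos h]
        gcongr
        have := Finset.single_le_sum (f := fun k => (Pi.single j 1 : ℕ → ℝ≥0∞) k *
          (if k = j then b else 0) ^ (1 / r)) (fun _ _ => zero_le)
          (Finset.mem_range.2 (Nat.lt_succ_iff.2 h))
        simpa using this
      · rw [if_neg h]; simp
    intro htop
    rw [htop, ENNReal.top_mul] at h3
    · exact hD (top_le_iff.1 h3)
    · rw [← ENNReal.rpow_mul]
      have : b ≠ ∞ := hb.ne_top
      simp only [ne_eq, ENNReal.rpow_eq_zero_iff]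
      rintro (h | h)
      · exact hb0.ne' h.1
      · exact this h.1
  -- The test sequence is c_j = d_j X_j^{1+r}, with d the increments of a and Y its sum. By the two
  -- power rules the left side of the inequality dominates ∑ g X^r a up to a constant, and that sum
  -- dominates Y. Hence Y ≲ D Y^q, and Y ≲ D^{1/(1-q)} = D^{1+r} provided Y is finite, which is why
  -- a is assumed finite and eventually constant.
  have main : ∀ a : ℕ → ℝ≥0∞, Monotone a → (∀ j, a j = 0 ∨ a j < σ j) → (∀ j, a j ≠ ∞) →
      (∃ n, ∀ j, n ≤ j → a j = a n) →
      ∑' i, e i * X i ^ r * a i ≤ (2 ^ (2 + r) * D) ^ (1 + r) := by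
    intro a ha haσ hatop ⟨n, hn⟩
    obtain ⟨d, had, hda, hd0⟩ := exists_eq_sum_range_succ ha
    set Y := ∑' j, d j * X j ^ (1 + r) with hY
    have hYtop : Y ≠ ∞ := by
      rw [hY, tsum_eq_sum (s := Finset.range (n + 1))]
      · refine (ENNReal.sum_lt_top.2 fun j _ => ?_).ne
        by_cases h : a j = 0
        · have : d j = 0 := le_antisymm (h ▸ hda j) zero_le
          simp [this]
        · have h2 : X j ≠ ∞ := hXtop j (fun h0 => by
            rcases haσ j with h3 | h3
            · exact h h3
            · simp [h0] at h3)
          exact ENNReal.mul_lt_top (lt_of_le_of_lt (hda j) (hatop j).lt_top)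
            (ENNReal.rpow_lt_top_of_nonneg (by positivity) h2)
      · intro j hj
        simp only [Finset.mem_range, not_lt] at hj
        obtain ⟨k, rfl⟩ : ∃ k, j = k + 1 := ⟨j - 1, by omega⟩
        rw [hd0 k (by rw [hn _ (by omega), hn k (by omega)]) (hatop k), zero_mul]
    have hsum : ∀ F : ℕ → ℝ≥0∞, ∑' i, F i * a i = ∑' j, d j * tailSum F j := by
      intro F
      rw [← tsum_mul_sum_range_succ]
      exact tsum_congr fun i => by rw [had]
    have hYle : Y ≤ 2 ^ (1 + r) * ∑' i, g i * X i ^ r * a i := by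
      rw [hsum, ← ENNReal.tsum_mul_left, hY]
      refine ENNReal.tsum_le_tsum fun j => ?_
      by_cases h : a j = 0
      · have : d j = 0 := le_antisymm (h ▸ hda j) zero_le
        simp [this]
      · have h2 : X j ≠ ∞ := hXtop j (fun h0 => by
            rcases haσ j with h3 | h3
            · exact h h3
            · simp [h0] at h3)
        calc d j * X j ^ (1 + r) ≤ d j * (2 ^ (1 + r) * tailSum (fun i => g i * X i ^ r) j) := by
              gcongr; exact tailSum_rpow_le hr0 h2
          _ = _ := by ring
    have htest : ∑' i, g i * X i ^ r * a i ≤ 2 * (D * Y ^ q) := by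
      have h1 := H (fun j => d j * X j ^ (1 + r)) a haσ
      refine le_trans ?_ (mul_le_mul_right h1 2)
      rw [← ENNReal.tsum_mul_left]
      refine ENNReal.tsum_le_tsum fun i => ?_
      have h2 : X i ^ (1 + r) * a i ^ (1 + 1 / r) ≤ 2 ^ (1 + 1 / r) *
          ∑ j ∈ Finset.range (i + 1), d j * X j ^ (1 + r) * a j ^ (1 / r) := by
        have h3 := sum_range_rpow_le (d := d) (s := 1 / r) (by positivity) (i := i)
          (by rw [← had]; exact hatop i)
        simp_rw [← had] at h3
        calc X i ^ (1 + r) * a i ^ (1 + 1 / r)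
            ≤ X i ^ (1 + r) * (2 ^ (1 + 1 / r) *
              ∑ j ∈ Finset.range (i + 1), d j * a j ^ (1 / r)) := by gcongr
          _ = 2 ^ (1 + 1 / r) *
              ∑ j ∈ Finset.range (i + 1), d j * X i ^ (1 + r) * a j ^ (1 / r) := by
              rw [mul_left_comm, Finset.mul_sum]
              congr 1
              refine Finset.sum_congr rfl fun j _ => by ring
          _ ≤ _ := by
              gcongr with j hj
              exact tailSum_antitone g (Nat.lt_succ_iff.1 (Finset.mem_range.1 hj))
      have h4 := ENNReal.rpow_le_rpow h2 hq0.le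
      rw [ENNReal.mul_rpow_of_nonneg _ _ hq0.le, ENNReal.mul_rpow_of_nonneg _ _ hq0.le,
        ← ENNReal.rpow_mul, ← ENNReal.rpow_mul, ← ENNReal.rpow_mul, hqr, hqs, ENNReal.rpow_one,
        ENNReal.rpow_one] at h4
      calc g i * X i ^ r * a i = g i * (X i ^ r * a i) := by ring
        _ ≤ g i * (2 * (∑ j ∈ Finset.range (i + 1), d j * X j ^ (1 + r) * a j ^ (1 / r)) ^ q) := by
            gcongr
        _ = _ := by ring
    have hYfin : Y ≤ (2 ^ (2 + r) * D) ^ (1 + r) := by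
      have h5 : Y ≤ 2 ^ (2 + r) * D * Y ^ q := by
        calc Y ≤ 2 ^ (1 + r) * (2 * (D * Y ^ q)) := hYle.trans (by gcongr)
          _ = _ := by
            rw [show (2 + r) = (1 + r) + 1 by ring,
              ENNReal.rpow_add_of_nonneg _ _ (by positivity) zero_le_one, ENNReal.rpow_one]
            ring
      by_cases hY0 : Y = 0
      · rw [hY0]; exact zero_le
      have h6 : Y ^ (1 - q) ≤ 2 ^ (2 + r) * D := by
        rw [ENNReal.rpow_sub _ _ hY0 hYtop, ENNReal.rpow_one]
        exact ENNReal.div_le_of_le_mul h5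
      calc Y = (Y ^ (1 - q)) ^ (1 + r) := by rw [← ENNReal.rpow_mul, hrq, ENNReal.rpow_one]
        _ ≤ _ := ENNReal.rpow_le_rpow h6 (by positivity)
    refine le_trans ?_ hYfin
    -- After summation by parts `e` enters only through its tails, so domination of tails replaces e
    -- ≤ g.
    rw [hsum, hY]
    refine ENNReal.tsum_le_tsum fun j => ?_
    gcongr
    rw [ENNReal.rpow_add_of_nonneg _ _ zero_le_one hr0.le, ENNReal.rpow_one]
    calc tailSum (fun i => e i * X i ^ r) j ≤ tailSum e j * X j ^ r := by
          rw [tailSum, tailSum, ← ENNReal.tsum_mul_right]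
          refine ENNReal.tsum_le_tsum fun i => ?_
          by_cases h : j ≤ i
          · rw [if_pos h, if_pos h]; gcongr; exact tailSum_antitone g h
          · simp [h]
      _ ≤ _ := by gcongr; exact he j
  -- Halving σ gives the strict inequality a < σ and costs the factor 2 of the conclusion; cutting
  -- at M gives finiteness, and freezing the index at n makes the sequence eventually constant.
  have hhalf : ∀ n M : ℕ, ∑ i ∈ Finset.range (n + 1), e i * X i ^ r * min (σ i / 2) M ≤
      (2 ^ (2 + r) * D) ^ (1 + r) := by
    intro n M
    refine le_trans ?_ (main (fun i => min (σ (min i n) / 2) M) ?_ ?_ ?_ ?_)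
    · refine le_trans (le_of_eq (Finset.sum_congr rfl fun i hi => ?_)) (ENNReal.sum_le_tsum
        (Finset.range (n + 1)))
      rw [min_eq_left (Nat.lt_succ_iff.1 (Finset.mem_range.1 hi))]
    · intro i j hij
      have h1 : σ (min i n) ≤ σ (min j n) := hσ (min_le_min_right n hij)
      simp only
      gcongr
    · intro j
      by_cases h0 : σ (min j n) = 0
      · left; simp [h0]
      · right
        refine lt_of_lt_of_le ?_ (hσ (min_le_left j n))
        by_cases ht : σ (min j n) = ∞
        · rw [ht]; exact lt_of_le_of_lt (min_le_right _ _) (ENNReal.natCast_lt_top M)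
        · exact lt_of_le_of_lt (min_le_left _ _) (ENNReal.half_lt_self h0 ht)
    · exact fun j => (lt_of_le_of_lt (min_le_right _ _) (ENNReal.natCast_lt_top M)).ne
    · exact ⟨n, fun j hj => by simp [min_eq_right hj]⟩
  have hfin : ∀ n, ∑ i ∈ Finset.range n, e i * X i ^ r * (σ i / 2) ≤
      (2 ^ (2 + r) * D) ^ (1 + r) := by
    intro n
    have h1 : ∀ i, e i * X i ^ r * (σ i / 2) = ⨆ M : ℕ, e i * X i ^ r * min (σ i / 2) M := by
      intro i
      rw [← ENNReal.mul_iSup]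
      congr 1
      have := inf_iSup_eq (σ i / 2) (fun M : ℕ => (M : ℝ≥0∞))
      rw [ENNReal.iSup_natCast, inf_top_eq] at this
      exact this
    simp_rw [h1]
    rw [ENNReal.finsetSum_iSup_of_monotone]
    · refine iSup_le fun M => le_trans ?_ (hhalf n M)
      exact Finset.sum_le_sum_of_subset (Finset.range_mono (Nat.le_succ n))
    · intro i M M' h
      simp only
      gcongr
  rw [ENNReal.tsum_eq_iSup_nat]
  refine iSup_le fun n => ?_
  calc ∑ i ∈ Finset.range n, e i * X i ^ r * σ i
      = 2 * ∑ i ∈ Finset.range n, e i * X i ^ r * (σ i / 2) := by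
        rw [Finset.mul_sum]
        refine Finset.sum_congr rfl fun i _ => ?_
        rw [mul_left_comm, two_mul, ENNReal.add_halves]
    _ ≤ _ := by gcongr; exact hfin n

/-! ### Tails of a finite measure without atoms -/

theorem continuous_measure_Ioi (m : Measure ℝ) [IsFiniteMeasure m] [NullSingletonClass m] :
    Continuous fun t : ℝ => m (Ioi t) := by
  rw [continuous_iff_continuousAt]
  intro t
  have h : ∀ s : ℝ, m (Ioi s) = ∫⁻ x, (Ioi s).indicator (fun _ => (1 : ℝ≥0∞)) x ∂m := fun s => by
    rw [lintegral_indicator measurableSet_Ioi]; simp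
  unfold ContinuousAt
  simp_rw [h]
  refine tendsto_lintegral_filter_of_dominated_convergence (fun _ => 1) ?_ ?_ (by simp) ?_
  · exact Filter.Eventually.of_forall fun s => (measurable_const.indicator measurableSet_Ioi)
  · refine Filter.Eventually.of_forall fun s => Filter.Eventually.of_forall fun x => ?_
    exact indicator_le_self' (fun _ _ => zero_le) x
  · have : ∀ᵐ x ∂m, x ≠ t := by simp [ae_iff]
    filter_upwards [this] with x hx
    refine tendsto_const_nhds.congr' ?_
    rcases lt_or_gt_of_ne hx with h | h
    · filter_upwards [lt_mem_nhds h] with s hs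
      rw [indicator_of_notMem (by simpa using h.le), indicator_of_notMem (by simpa using hs.le)]
    · filter_upwards [gt_mem_nhds h] with s hs
      rw [indicator_of_mem (by simpa using h), indicator_of_mem (by simpa using hs)]

theorem exists_measure_Ioi_eq (m : Measure ℝ) [IsFiniteMeasure m] [NullSingletonClass m] {x t : ℝ}
    (hxt : x ≤ t) {c : ℝ≥0∞} (h1 : m (Ioi t) ≤ c) (h2 : c ≤ m (Ioi x)) :
    ∃ b ∈ Icc x t, m (Ioi b) = c :=
  intermediate_value_Icc' hxt (continuous_measure_Ioi m).continuousOn ⟨h1, h2⟩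

/-- Continuous power rule. If the tail at t is below G/2, some b has tail exactly G/2; between x and
b the tails lie in [G/2, G], and that interval has mass G/2. The quotient m^r/m, unlike a power r -
1, is 0 where the tail vanishes, for every r > 0. -/
theorem measure_Ioi_rpow_le (m : Measure ℝ) [IsFiniteMeasure m] [NullSingletonClass m] {r : ℝ} (hr : 0 < r)
    {x t : ℝ} (hxt : x ≤ t) :
    m (Ioi x) ^ r ≤ 2 ^ r *
      (2 * ∫⁻ s in Ioo x t, m (Ioi s) ^ r / m (Ioi s) ∂m + m (Ioi t) ^ r) := by
  set G := m (Ioi x) with hG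
  have hGtop : G ≠ ∞ := measure_ne_top _ _
  have hG2 : G = 2 * (G / 2) := by rw [two_mul, ENNReal.add_halves]
  by_cases hG0 : G = 0
  · rw [hG0, ENNReal.zero_rpow_of_pos hr]; exact zero_le
  conv_lhs => rw [hG2]
  rw [ENNReal.mul_rpow_of_nonneg _ _ hr.le]
  gcongr
  rcases le_or_gt (G / 2) (m (Ioi t)) with h | h
  · exact le_trans (ENNReal.rpow_le_rpow h hr.le) le_add_self
  obtain ⟨b, hb, hbG⟩ := exists_measure_Ioi_eq m hxt h.le ENNReal.half_le_self
  refine le_trans ?_ le_self_add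
  have hmb : m (Ioo x b) = G / 2 := by
    have h1 : m (Ioc x b) + m (Ioi b) = G := by
      rw [← measure_union (Ioc_disjoint_Ioi le_rfl) measurableSet_Ioi, Ioc_union_Ioi_eq_Ioi hb.1]
    rw [measure_congr Ioo_ae_eq_Ioc]
    rw [hbG] at h1
    have h2 : m (Ioc x b) + G / 2 = G / 2 + G / 2 := by rw [h1, ENNReal.add_halves]
    exact (ENNReal.add_left_inj (ne_top_of_le_ne_top hGtop ENNReal.half_le_self)).1 h2
  calc (G / 2) ^ r = 2 * ((G / 2) ^ r / G * (G / 2)) := by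
        rw [mul_left_comm, ← hG2, ENNReal.div_mul_cancel hG0 hGtop]
    _ = 2 * ∫⁻ s in Ioo x b, (G / 2) ^ r / G ∂m := by rw [setLIntegral_const, hmb]
    _ ≤ 2 * ∫⁻ s in Ioo x b, m (Ioi s) ^ r / m (Ioi s) ∂m := by
        refine mul_le_mul_right (setLIntegral_mono' measurableSet_Ioo fun s hs => ?_) 2
        have h1 : G / 2 ≤ m (Ioi s) := by
          rw [← hbG]; exact measure_mono (Ioi_subset_Ioi hs.2.le)
        have h2 : m (Ioi s) ≤ G := measure_mono (Ioi_subset_Ioi hs.1.le)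
        gcongr
    _ ≤ _ := by gcongr; exact hb.2

/-! ### Kernel tails, essential suprema and their measurability -/

/-- `∫_{(s,∞)} U(x,u)^q dν(u)`. -/
noncomputable def kernelTail (q : ℝ) (U : ℝ → ℝ → ℝ≥0) (ν : Measure ℝ) (x s : ℝ) : ℝ≥0∞ :=
  ∫⁻ u in Ioi s, (U x u : ℝ≥0∞) ^ q ∂ν

/-- The essential supremum of `U(z,t)^p v(z)^{-r}` over `z ∈ (0,t)`. -/
noncomputable def kernelSup (p r : ℝ) (U : ℝ → ℝ → ℝ≥0) (v : ℝ → ℝ≥0∞) (t : ℝ) : ℝ≥0∞ :=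
  essSup (fun z => (U z t : ℝ≥0∞) ^ p * v z ^ (-r)) (volume.restrict (Ioo 0 t))

/-- The sum of the integrands of `A₃*` and `A₄*` with respect to `ν = w dt`. -/
noncomputable def condDensity (q r : ℝ) (U : ℝ → ℝ → ℝ≥0) (v : ℝ → ℝ≥0∞) (ν : Measure ℝ)
    (t : ℝ) : ℝ≥0∞ :=
  ν (Ioi t) ^ r * kernelSup r r U v t + kernelTail q U ν t t ^ r * kernelSup q r U v t

theorem measurable_measure_Ioi (ν : Measure ℝ) : Measurable fun t => ν (Ioi t) :=
  Antitone.measurable fun _ _ h => measure_mono (Ioi_subset_Ioi h)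

theorem measurable_kernelTail (q : ℝ) (U : ℝ → ℝ → ℝ≥0) (ν : Measure ℝ) (x : ℝ) :
    Measurable (kernelTail q U ν x) :=
  Antitone.measurable fun _ _ h => lintegral_mono_set (Ioi_subset_Ioi h)

namespace IsRegularKernel

variable {θ : ℝ≥0} {U : ℝ → ℝ → ℝ≥0}

theorem le_left (hU : IsRegularKernel θ U) {x x' y : ℝ} (hx : 0 ≤ x) (hxx : x ≤ x') (hy : 0 ≤ y) :
    U x' y ≤ U x y :=
  hU.antitone_left y hy hx (hx.trans hxx) hxx

theorem le_right (hU : IsRegularKernel θ U) {x y y' : ℝ} (hx : 0 ≤ x) (hy : 0 ≤ y) (hyy : y ≤ y') :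
    U x y ≤ U x y' :=
  hU.monotone_right x hx hy (hy.trans hyy) hyy

theorem rpow_le_left (hU : IsRegularKernel θ U) {p : ℝ} (hp : 0 ≤ p) {x x' y : ℝ} (hx : 0 ≤ x)
    (hxx : x ≤ x') (hy : 0 ≤ y) : (U x' y : ℝ≥0∞) ^ p ≤ (U x y : ℝ≥0∞) ^ p :=
  ENNReal.rpow_le_rpow (ENNReal.coe_le_coe.2 (hU.le_left hx hxx hy)) hp

theorem rpow_le_right (hU : IsRegularKernel θ U) {p : ℝ} (hp : 0 ≤ p) {x y y' : ℝ} (hx : 0 ≤ x)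
    (hy : 0 ≤ y) (hyy : y ≤ y') : (U x y : ℝ≥0∞) ^ p ≤ (U x y' : ℝ≥0∞) ^ p :=
  ENNReal.rpow_le_rpow (ENNReal.coe_le_coe.2 (hU.le_right hx hy hyy)) hp

theorem rpow_triangle (hU : IsRegularKernel θ U) {q : ℝ} (hq0 : 0 ≤ q) (hq1 : q ≤ 1) {x y z : ℝ}
    (hx : 0 ≤ x) (hxy : x < y) (hyz : y < z) :
    (U x z : ℝ≥0∞) ^ q ≤ (θ : ℝ≥0∞) ^ q * ((U x y : ℝ≥0∞) ^ q + (U y z : ℝ≥0∞) ^ q) := by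
  have h : (U x z : ℝ≥0∞) ≤ θ * (U x y + U y z) := by exact_mod_cast hU.triangle x y z hx hxy hyz
  calc (U x z : ℝ≥0∞) ^ q ≤ (θ * (U x y + U y z)) ^ q := ENNReal.rpow_le_rpow h hq0
    _ = (θ : ℝ≥0∞) ^ q * ((U x y : ℝ≥0∞) + U y z) ^ q := ENNReal.mul_rpow_of_nonneg _ _ hq0
    _ ≤ _ := by gcongr; exact ENNReal.rpow_add_le_add_rpow _ _ hq0 hq1

theorem aemeasurable_right (hU : IsRegularKernel θ U) {ν : Measure ℝ}
    (hν : ν ≪ volume.restrict (Ioi (0 : ℝ))) {x : ℝ} (hx : 0 ≤ x) :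
    AEMeasurable (fun t => (U x t : ℝ≥0∞)) ν := by
  have h : AEMeasurable (fun t => U x t) (volume.restrict (Ioi (0 : ℝ))) :=
    aemeasurable_restrict_of_monotoneOn measurableSet_Ioi
      ((hU.monotone_right x hx).mono Ioi_subset_Ici_self)
  exact (h.mono_ac hν).coe_nnreal_ennreal

theorem aemeasurable_left (hU : IsRegularKernel θ U) {t : ℝ} (ht : 0 ≤ t) :
    AEMeasurable (fun x => (U x t : ℝ≥0∞)) (volume.restrict (Ioi (0 : ℝ))) := by
  have h : AEMeasurable (fun x => U x t) (volume.restrict (Ioi (0 : ℝ))) :=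
    aemeasurable_restrict_of_antitoneOn measurableSet_Ioi
      ((hU.antitone_left t ht).mono Ioi_subset_Ici_self)
  exact h.coe_nnreal_ennreal

theorem aemeasurable_prod (hU : IsRegularKernel θ U) {μ ν : Measure ℝ} [SFinite ν]
    (hμ : μ ≪ volume.restrict (Ioi (0 : ℝ))) (hν : ν ≪ volume.restrict (Ioi (0 : ℝ))) :
    AEMeasurable (fun p : ℝ × ℝ => (U p.1 p.2 : ℝ≥0∞)) (μ.prod ν) := by
  refine AEMeasurable.coe_nnreal_ennreal (hU.measurable.mono_ac ((hμ.prod hν).trans ?_))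
  rw [Measure.prod_restrict]
  exact Measure.absolutelyContinuous_of_le (Measure.restrict_mono
    (prod_mono Ioi_subset_Ici_self Ioi_subset_Ici_self) le_rfl)

theorem kernelTail_le (hU : IsRegularKernel θ U) {q : ℝ} (hq0 : 0 ≤ q) (hq1 : q ≤ 1)
    (ν : Measure ℝ) {x s : ℝ} (hx : 0 ≤ x) (hxs : x < s) :
    kernelTail q U ν x s ≤
      (θ : ℝ≥0∞) ^ q * ((U x s : ℝ≥0∞) ^ q * ν (Ioi s) + kernelTail q U ν s s) := by
  unfold kernelTail
  calc ∫⁻ u in Ioi s, (U x u : ℝ≥0∞) ^ q ∂ν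
      ≤ ∫⁻ u in Ioi s, (θ : ℝ≥0∞) ^ q * ((U x s : ℝ≥0∞) ^ q + (U s u : ℝ≥0∞) ^ q) ∂ν :=
        setLIntegral_mono' measurableSet_Ioi fun u hu => hU.rpow_triangle hq0 hq1 hx hxs hu
    _ = _ := by
        rw [lintegral_const_mul' _ _ (ENNReal.rpow_ne_top_of_nonneg hq0 ENNReal.coe_ne_top),
          lintegral_add_left measurable_const, setLIntegral_const]

theorem rpow_mul_measure_le_kernelTail (hU : IsRegularKernel θ U) {q : ℝ} (hq0 : 0 ≤ q)
    (ν : Measure ℝ) {x s : ℝ} (hx : 0 ≤ x) (hxs : x ≤ s) :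
    (U x s : ℝ≥0∞) ^ q * ν (Ioi s) ≤ kernelTail q U ν x s := by
  unfold kernelTail
  rw [← setLIntegral_const]
  exact setLIntegral_mono' measurableSet_Ioi fun u hu =>
    hU.rpow_le_right hq0 hx (hx.trans hxs) (le_of_lt hu)

theorem kernelTail_le_kernelTail (hU : IsRegularKernel θ U) {q : ℝ} (hq0 : 0 ≤ q)
    (ν : Measure ℝ) {x y s t : ℝ} (hx : 0 ≤ x) (hxy : x ≤ y) (hys : y ≤ t) (hst : s ≤ t) :
    kernelTail q U ν y t ≤ kernelTail q U ν x s := by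
  unfold kernelTail
  refine le_trans (setLIntegral_mono' measurableSet_Ioi fun u hu => ?_)
    (lintegral_mono_set (Ioi_subset_Ioi hst))
  exact hU.rpow_le_left hq0 hx hxy ((hx.trans (hxy.trans hys)).trans (le_of_lt hu))

theorem kernelSup_mono (hU : IsRegularKernel θ U) {p : ℝ} (hp : 0 ≤ p) (r : ℝ) (v : ℝ → ℝ≥0∞) :
    Monotone (kernelSup p r U v) := by
  intro s t hst
  unfold kernelSup
  refine le_trans (essSup_mono_ae ?_)
    (essSup_mono_measure' (Measure.restrict_mono (Ioo_subset_Ioo_right hst) le_rfl))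
  filter_upwards [ae_restrict_mem measurableSet_Ioo] with z hz
  gcongr
  exact hU.le_right hz.1.le (hz.1.trans hz.2).le hst

theorem aemeasurable_condDensity (hU : IsRegularKernel θ U) {q r : ℝ} (hq : 0 ≤ q) (hr : 0 ≤ r)
    (v : ℝ → ℝ≥0∞) {ν : Measure ℝ} (hν : ν ≪ volume.restrict (Ioi (0 : ℝ))) :
    AEMeasurable (condDensity q r U v ν) ν ∧ AEMeasurable (fun t => kernelTail q U ν t t) ν := by
  have hV : AEMeasurable (fun t => kernelTail q U ν t t) ν := by
    refine AEMeasurable.mono_ac (aemeasurable_restrict_of_antitoneOn measurableSet_Ioi ?_) hν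
    intro s hs t ht hst
    exact hU.kernelTail_le_kernelTail hq ν (le_of_lt hs) hst le_rfl hst
  refine ⟨?_, hV⟩
  exact (((measurable_measure_Ioi ν).pow_const r).aemeasurable.mul
    (hU.kernelSup_mono hr r v).measurable.aemeasurable).add
    ((hV.pow_const r).mul (hU.kernelSup_mono hq r v).measurable.aemeasurable)

/-- For fixed t the bound holds off a null set of x depending on t. Joint measurability of U lets
Tonelli exchange the quantifiers: the truncated difference of the two sides has integral zero over
the product. -/
theorem ae_ae_le_kernelSup (hU : IsRegularKernel θ U) {p : ℝ} (hp : 0 ≤ p) (r : ℝ)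
    {v : ℝ → ℝ≥0∞} (hv : NonnegMeasurable v) {ν : Measure ℝ} [SFinite ν]
    (hν : ν ≪ volume.restrict (Ioi (0 : ℝ))) :
    ∀ᵐ x ∂(volume.restrict (Ioi (0 : ℝ))), ∀ᵐ t ∂ν, x < t →
      (U x t : ℝ≥0∞) ^ p * v x ^ (-r) ≤ kernelSup p r U v t := by
  set μ := volume.restrict (Ioi (0 : ℝ)) with hμ
  set h : ℝ × ℝ → ℝ≥0∞ := {z : ℝ × ℝ | z.1 < z.2}.indicator
    fun z => (U z.1 z.2 : ℝ≥0∞) ^ p * v z.1 ^ (-r) - kernelSup p r U v z.2 with hh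
  have hm : AEMeasurable h (μ.prod ν) := by
    refine AEMeasurable.indicator ?_ (measurableSet_lt measurable_fst measurable_snd)
    refine AEMeasurable.sub (AEMeasurable.mul ?_ ?_) ?_
    · exact (hU.aemeasurable_prod Measure.AbsolutelyContinuous.rfl hν).pow_const p
    · exact (AEMeasurable.comp_quasiMeasurePreserving hv
        Measure.quasiMeasurePreserving_fst).pow_const (-r)
    · exact ((hU.kernelSup_mono hp r v).measurable.comp measurable_snd).aemeasurable
  have h0 : ∫⁻ z, h z ∂(μ.prod ν) = 0 := by
    rw [lintegral_prod_symm _ hm]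
    refine (lintegral_congr fun t => ?_).trans lintegral_zero
    rw [← lintegral_zero (μ := μ)]
    refine lintegral_congr_ae ?_
    have hle := ENNReal.ae_le_essSup (μ := volume.restrict (Ioo 0 t))
      (fun z => (U z t : ℝ≥0∞) ^ p * v z ^ (-r))
    rw [ae_restrict_iff' measurableSet_Ioo] at hle
    rw [Filter.EventuallyEq, hμ, ae_restrict_iff' measurableSet_Ioi]
    filter_upwards [hle] with x hx hx0
    simp only [hh, indicator]
    split_ifs with hxt
    · exact tsub_eq_zero_of_le (hx ⟨hx0, hxt⟩)
    · rfl
  rw [lintegral_eq_zero_iff' hm] at h0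
  filter_upwards [Measure.ae_ae_of_ae_prod h0] with x hx
  filter_upwards [hx] with t ht hxt
  simp only [hh, indicator, mem_ofPred_eq, hxt, if_true, Pi.zero_apply] at ht
  exact tsub_eq_zero_iff_le.1 ht

end IsRegularKernel

/-! ### Sufficiency: the auxiliary weight -/

/-- The quotient `n / t`, with value `∞` for `t = 0`. -/
noncomputable def divTop (n t : ℝ≥0∞) : ℝ≥0∞ := n / t + if t = 0 then ∞ else 0

theorem mul_divTop_le (n t : ℝ≥0∞) : t * divTop n t ≤ n := by
  unfold divTop
  by_cases h : t = 0
  · simp [h]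
  · rw [if_neg h, add_zero]; exact ENNReal.mul_div_le

/-- The value ∞ at t = 0 makes the bound trivial there, while `mul_divTop_le` is not harmed because
0 · ∞ = 0. -/
theorem le_mul_divTop {k n t y : ℝ≥0∞} (hk : k ≠ 0) (ht : t ≠ ∞) (h : t * y ≤ k * n) :
    y ≤ k * divTop n t := by
  unfold divTop
  by_cases h0 : t = 0
  · simp [h0, hk]
  · rw [if_neg h0, add_zero, ← mul_div_assoc, ENNReal.le_div_iff_mul_le (Or.inl h0) (Or.inl ht),
      mul_comm]
    exact h

theorem AEMeasurable.divTop {ν : Measure ℝ} {f g : ℝ → ℝ≥0∞} (hf : AEMeasurable f ν)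
    (hg : AEMeasurable g ν) : AEMeasurable (fun t => divTop (f t) (g t)) ν := by
  unfold _root_.divTop
  refine (hf.div hg).add ?_
  have : Measurable fun t : ℝ≥0∞ => if t = 0 then (∞ : ℝ≥0∞) else 0 :=
    Measurable.ite (measurableSet_singleton 0) measurable_const measurable_const
  exact this.comp_aemeasurable hg

/-- The auxiliary weight dominating the essential suprema that have to be tested in the proof of
the sufficiency part. -/
noncomputable def auxWeight (q r : ℝ) (U : ℝ → ℝ → ℝ≥0) (v : ℝ → ℝ≥0∞) (ν : Measure ℝ)
    (t : ℝ) : ℝ≥0∞ :=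
  condDensity q r U v ν t + ∫⁻ s in Iio t, (divTop (condDensity q r U v ν s) (ν (Ioi s)) +
    divTop (condDensity q r U v ν s) (kernelTail q U ν s s) * (U s t : ℝ≥0∞) ^ q) ∂ν

section Sufficiency

variable {q r : ℝ} {θ : ℝ≥0} {U : ℝ → ℝ → ℝ≥0} {v : ℝ → ℝ≥0∞} {ν : Measure ℝ}

theorem aemeasurable_auxWeight_kernel (hU : IsRegularKernel θ U) (hq : 0 ≤ q) (hr : 0 ≤ r)
    [SFinite ν] (hν : ν ≪ volume.restrict (Ioi (0 : ℝ))) :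
    AEMeasurable (Function.uncurry fun t s => (Iio t).indicator (fun s =>
      divTop (condDensity q r U v ν s) (ν (Ioi s)) +
      divTop (condDensity q r U v ν s) (kernelTail q U ν s s) * (U s t : ℝ≥0∞) ^ q) s)
      (ν.prod ν) := by
  obtain ⟨hN, hV⟩ := hU.aemeasurable_condDensity hq hr v hν
  have h1 := hN.divTop (measurable_measure_Ioi ν).aemeasurable
  have h2 := hN.divTop hV
  have hUm : AEMeasurable (fun p : ℝ × ℝ => (U p.2 p.1 : ℝ≥0∞)) (ν.prod ν) := by
    have := (hU.aemeasurable_prod hν hν)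
    exact (this.comp_quasiMeasurePreserving
      (Measure.measurePreserving_swap (μ := ν) (ν := ν)).quasiMeasurePreserving)
  have h3 : AEMeasurable (fun p : ℝ × ℝ =>
      divTop (condDensity q r U v ν p.2) (ν (Ioi p.2)) +
      divTop (condDensity q r U v ν p.2) (kernelTail q U ν p.2 p.2) * (U p.2 p.1 : ℝ≥0∞) ^ q)
      (ν.prod ν) :=
    (h1.comp_quasiMeasurePreserving Measure.quasiMeasurePreserving_snd).add
      ((h2.comp_quasiMeasurePreserving Measure.quasiMeasurePreserving_snd).mul
        (hUm.pow_const q))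
  refine (h3.indicator (measurableSet_lt measurable_snd measurable_fst)).congr
    (Filter.Eventually.of_forall ?_)
  rintro ⟨t, s⟩
  simp only [Function.uncurry, indicator]
  rfl

theorem aemeasurable_auxWeight (hU : IsRegularKernel θ U) (hq : 0 ≤ q) (hr : 0 ≤ r)
    [SFinite ν] (hν : ν ≪ volume.restrict (Ioi (0 : ℝ))) :
    AEMeasurable (auxWeight q r U v ν) ν := by
  refine (hU.aemeasurable_condDensity hq hr v hν).1.add ?_
  have := (aemeasurable_auxWeight_kernel (v := v) hU hq hr hν).lintegral_prod_right'
  refine this.congr (Filter.Eventually.of_forall fun t => ?_)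
  exact lintegral_indicator measurableSet_Iio _

/-- After Tonelli, integrating the two added terms over t > s multiplies N(s)/ν(s,∞) by ν(s,∞) and
N(s)/V(s) by V(s). Each contributes at most N(s). -/
theorem lintegral_auxWeight_le (hU : IsRegularKernel θ U) (hq : 0 ≤ q) (hr : 0 ≤ r)
    [SFinite ν] (hν : ν ≪ volume.restrict (Ioi (0 : ℝ))) :
    ∫⁻ t, auxWeight q r U v ν t ∂ν ≤ 3 * ∫⁻ t, condDensity q r U v ν t ∂ν := by
  unfold auxWeight
  rw [lintegral_add_left' (hU.aemeasurable_condDensity hq hr v hν).1]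
  simp_rw [← lintegral_indicator measurableSet_Iio]
  rw [lintegral_lintegral_swap (aemeasurable_auxWeight_kernel hU hq hr hν)]
  have h3 : (3 : ℝ≥0∞) * ∫⁻ t, condDensity q r U v ν t ∂ν =
      ∫⁻ t, condDensity q r U v ν t ∂ν + ∫⁻ t, 2 * condDensity q r U v ν t ∂ν := by
    rw [lintegral_const_mul' _ _ (by simp)]; ring
  rw [h3]
  refine add_le_add le_rfl ?_
  have hpos : ∀ᵐ s ∂ν, 0 < s := hν.ae_le (ae_restrict_mem measurableSet_Ioi)
  refine lintegral_mono_ae ?_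
  filter_upwards [hpos] with s hs
  set N := condDensity q r U v ν s
  calc ∫⁻ t, (Iio t).indicator (fun s => divTop (condDensity q r U v ν s) (ν (Ioi s)) +
        divTop (condDensity q r U v ν s) (kernelTail q U ν s s) * (U s t : ℝ≥0∞) ^ q) s ∂ν
      = ∫⁻ t in Ioi s, (divTop N (ν (Ioi s)) +
          divTop N (kernelTail q U ν s s) * (U s t : ℝ≥0∞) ^ q) ∂ν := by
        rw [← lintegral_indicator measurableSet_Ioi]
        refine lintegral_congr fun t => ?_
        simp [indicator, N]
    _ = divTop N (ν (Ioi s)) * ν (Ioi s) +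
          divTop N (kernelTail q U ν s s) * kernelTail q U ν s s := by
        rw [lintegral_add_left measurable_const, setLIntegral_const, lintegral_const_mul'']
        · rfl
        · exact ((hU.aemeasurable_right hν hs.le).pow_const q).restrict
    _ ≤ 2 * N := by
        rw [mul_comm _ (ν (Ioi s)), mul_comm _ (kernelTail q U ν s s), two_mul]
        exact add_le_add (mul_divTop_le _ _) (mul_divTop_le _ _)

/-- The triangle inequality splits the tail into U(x,s)^q ν(s,∞) and V(s). Since q + qr = r, the
first piece produces U(x,s)^r, which meets the supremum of A₃*; the second meets that of A₄*. -/
theorem kernelTail_rpow_le_condDensity (hU : IsRegularKernel θ U) (hq0 : 0 < q) (hq1 : q < 1)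
    (hr : r = q / (1 - q)) {x s : ℝ} (hx : 0 ≤ x) (hxs : x < s)
    (hS : (U x s : ℝ≥0∞) ^ r * v x ^ (-r) ≤ kernelSup r r U v s)
    (hR : (U x s : ℝ≥0∞) ^ q * v x ^ (-r) ≤ kernelSup q r U v s) :
    v x ^ (-r) * (U x s : ℝ≥0∞) ^ q * kernelTail q U ν x s ^ r ≤
      ((θ : ℝ≥0∞) ^ r) ^ q * 2 ^ r * condDensity q r U v ν s := by
  have h1q : 0 < 1 - q := by linarith
  have hr0 : 0 < r := by rw [hr]; positivity
  have hqr : q + q * r = r := by rw [hr]; field_simp; ring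
  have hF := hU.kernelTail_le hq0.le hq1.le ν hx hxs
  have h1 : kernelTail q U ν x s ^ r ≤ ((θ : ℝ≥0∞) ^ r) ^ q * (2 ^ r *
      (((U x s : ℝ≥0∞) ^ q) ^ r * ν (Ioi s) ^ r + kernelTail q U ν s s ^ r)) := by
    refine (ENNReal.rpow_le_rpow hF hr0.le).trans ?_
    rw [ENNReal.mul_rpow_of_nonneg _ _ hr0.le, ← ENNReal.rpow_mul, mul_comm q r, ENNReal.rpow_mul,
      ← ENNReal.mul_rpow_of_nonneg _ _ hr0.le]
    gcongr
    exact ENNReal.add_rpow_le_two_rpow_mul hr0.le _ _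
  have h2 : (U x s : ℝ≥0∞) ^ q * ((U x s : ℝ≥0∞) ^ q) ^ r = (U x s : ℝ≥0∞) ^ r := by
    rw [← ENNReal.rpow_mul, ← ENNReal.rpow_add_of_nonneg _ _ hq0.le (by positivity), hqr]
  calc v x ^ (-r) * (U x s : ℝ≥0∞) ^ q * kernelTail q U ν x s ^ r
      ≤ v x ^ (-r) * (U x s : ℝ≥0∞) ^ q * (((θ : ℝ≥0∞) ^ r) ^ q * (2 ^ r *
      (((U x s : ℝ≥0∞) ^ q) ^ r * ν (Ioi s) ^ r + kernelTail q U ν s s ^ r))) := by gcongr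
    _ = ((θ : ℝ≥0∞) ^ r) ^ q * 2 ^ r * (ν (Ioi s) ^ r *
          ((U x s : ℝ≥0∞) ^ q * ((U x s : ℝ≥0∞) ^ q) ^ r * v x ^ (-r)) +
          kernelTail q U ν s s ^ r * ((U x s : ℝ≥0∞) ^ q * v x ^ (-r))) := by ring
    _ ≤ _ := by
        rw [h2]
        unfold condDensity
        gcongr

theorem kernelTail_ne_top (hU : IsRegularKernel θ U) (hq0 : 0 < q) [IsFiniteMeasure ν] {n : ℝ}
    (hνn : ν (Ioi n) = 0) {x s : ℝ} (hx : 0 ≤ x) (hs : 0 ≤ s) :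
    kernelTail q U ν x s ≠ ∞ := by
  have h : kernelTail q U ν x s ≤ ∫⁻ u in Ioi s, (U x n : ℝ≥0∞) ^ q ∂ν := by
    refine lintegral_mono_ae ?_
    have h1 : ∀ᵐ u ∂(ν.restrict (Ioi s)), ¬ n < u := by
      refine ae_restrict_of_ae ?_
      filter_upwards [measure_eq_zero_iff_ae_notMem.1 hνn] with u hu using by simpa using hu
    filter_upwards [h1, ae_restrict_mem measurableSet_Ioi] with u hu hus
    exact hU.rpow_le_right hq0.le hx (hs.trans (le_of_lt hus)) (not_lt.1 hu)
  refine ne_top_of_le_ne_top ?_ h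
  rw [setLIntegral_const]
  exact ENNReal.mul_ne_top (ENNReal.rpow_ne_top_of_nonneg hq0.le ENNReal.coe_ne_top)
    (measure_ne_top _ _)

/-- The power rule for the measure U(x,u)^q dν(u) on (x,∞), whose tail at s ≥ x is `kernelTail q U ν
x s`. -/
theorem kernelTail_rpow_le_lintegral (hU : IsRegularKernel θ U) (hq0 : 0 < q) (hr0 : 0 < r)
    [IsFiniteMeasure ν] (hν : ν ≪ volume.restrict (Ioi (0 : ℝ))) {n : ℝ}
    (hνn : ν (Ioi n) = 0) {x t : ℝ} (hx : 0 ≤ x) (hxt : x ≤ t) :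
    kernelTail q U ν x x ^ r ≤ 2 ^ r * (2 * ∫⁻ s in Ioo x t, (U x s : ℝ≥0∞) ^ q *
      (kernelTail q U ν x s ^ r / kernelTail q U ν x s) ∂ν + kernelTail q U ν x t ^ r) := by
  set a : ℝ → ℝ≥0∞ := fun u => (U x u : ℝ≥0∞) ^ q with ha
  have ham : AEMeasurable a ν := (hU.aemeasurable_right hν hx).pow_const q
  set m := (ν.restrict (Ioi x)).withDensity a with hm
  have hac : m ≪ volume := (withDensity_absolutelyContinuous _ _).trans
    (Measure.restrict_le_self.absolutelyContinuous.trans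
      (hν.trans Measure.restrict_le_self.absolutelyContinuous))
  have hmI : ∀ s, x ≤ s → m (Ioi s) = kernelTail q U ν x s := by
    intro s hs
    rw [hm, withDensity_apply _ measurableSet_Ioi, Measure.restrict_restrict measurableSet_Ioi,
      inter_eq_left.2 (Ioi_subset_Ioi hs)]
    rfl
  have : IsFiniteMeasure m := ⟨by
    rw [hm, withDensity_apply _ MeasurableSet.univ, Measure.restrict_univ]
    exact (kernelTail_ne_top hU hq0 hνn hx hx).lt_top⟩
  have : NullSingletonClass m := ⟨fun p => hac (by simp)⟩
  have h := measure_Ioi_rpow_le m hr0 hxt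
  rw [hmI x le_rfl, hmI t hxt] at h
  convert h using 4
  have hFm : Measurable fun s => m (Ioi s) ^ r / m (Ioi s) :=
    ((measurable_measure_Ioi m).pow_const r).div (measurable_measure_Ioi m)
  rw [hm, restrict_withDensity measurableSet_Ioo, Measure.restrict_restrict measurableSet_Ioo,
    inter_eq_left.2 Ioo_subset_Ioi_self, ← hm,
    lintegral_withDensity_eq_lintegral_mul₀ ham.restrict hFm.aemeasurable]
  refine setLIntegral_congr_fun measurableSet_Ioo fun s hs => ?_
  simp only [Pi.mul_apply, hmI s hs.1.le, ha]

/-- The power rule turns V(x)^r into an integral over s in (x,t) plus a term at t, and under the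
integral U(x,t)^q is split at s. Both U(x,s)^q ν(s,∞) and V(s) are at most F(s), the tail of
U(x,·)^q at s, so one factor 1/F(s) can be traded for the denominators ν(s,∞) and V(s) of the
auxiliary weight. -/
theorem rpow_mul_kernelTail_le_auxWeight (hU : IsRegularKernel θ U) (hθ : 0 < θ) (hq0 : 0 < q)
    (hq1 : q < 1) (hr : r = q / (1 - q))
    [IsFiniteMeasure ν] (hν : ν ≪ volume.restrict (Ioi (0 : ℝ))) {n : ℝ}
    (hνn : ν (Ioi n) = 0) {x t : ℝ} (hx : 0 ≤ x) (hxt : x < t)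
    (hS : ∀ᵐ s ∂ν, x < s → (U x s : ℝ≥0∞) ^ r * v x ^ (-r) ≤ kernelSup r r U v s)
    (hR : ∀ᵐ s ∂ν, x < s → (U x s : ℝ≥0∞) ^ q * v x ^ (-r) ≤ kernelSup q r U v s)
    (hSt : (U x t : ℝ≥0∞) ^ r * v x ^ (-r) ≤ kernelSup r r U v t)
    (hRt : (U x t : ℝ≥0∞) ^ q * v x ^ (-r) ≤ kernelSup q r U v t) :
    v x ^ (-r) * (U x t : ℝ≥0∞) ^ q * kernelTail q U ν x x ^ r ≤
      2 ^ r * (((θ : ℝ≥0∞) ^ r) ^ q * 2 ^ r) * (2 * (θ : ℝ≥0∞) ^ q + 1) *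
        auxWeight q r U v ν t := by
  have h1q : 0 < 1 - q := by linarith
  have hr0 : 0 < r := by rw [hr]; positivity
  set c := v x ^ (-r) with hc
  set K := ((θ : ℝ≥0∞) ^ r) ^ q * 2 ^ r with hK
  have hK0 : K ≠ 0 := by
    refine mul_ne_zero ?_ ?_
    · simp [ENNReal.rpow_eq_zero_iff, hθ.ne', hq0.not_gt, hr0.not_gt]
    · simp [ENNReal.rpow_eq_zero_iff]
  set F := kernelTail q U ν x with hF
  have hFm : Measurable F := measurable_kernelTail q U ν x
  have hUm : AEMeasurable (fun s => (U x s : ℝ≥0∞) ^ q) ν :=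
    (hU.aemeasurable_right hν hx).pow_const q
  have hfirst : c * (U x t : ℝ≥0∞) ^ q *
      ∫⁻ s in Ioo x t, (U x s : ℝ≥0∞) ^ q * (F s ^ r / F s) ∂ν ≤
      (θ : ℝ≥0∞) ^ q * (K * auxWeight q r U v ν t) := by
    have hprod : AEMeasurable (fun s => (U x s : ℝ≥0∞) ^ q * (F s ^ r / F s)) ν :=
      hUm.mul ((hFm.pow_const r).div hFm).aemeasurable
    rw [← lintegral_const_mul'' _ hprod.restrict]
    calc ∫⁻ s in Ioo x t, c * (U x t : ℝ≥0∞) ^ q * ((U x s : ℝ≥0∞) ^ q * (F s ^ r / F s)) ∂ν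
        ≤ ∫⁻ s in Ioo x t, (θ : ℝ≥0∞) ^ q * (K * (divTop (condDensity q r U v ν s) (ν (Ioi s)) +
          divTop (condDensity q r U v ν s) (kernelTail q U ν s s) * (U s t : ℝ≥0∞) ^ q)) ∂ν := by
          refine lintegral_mono_ae ?_
          filter_upwards [ae_restrict_of_ae hS, ae_restrict_of_ae hR,
            ae_restrict_mem measurableSet_Ioo] with s hSs hRs hs
          have hN : c * (U x s : ℝ≥0∞) ^ q * F s ^ r ≤ K * condDensity q r U v ν s :=
            kernelTail_rpow_le_condDensity hU hq0 hq1 hr hx hs.1 (hSs hs.1) (hRs hs.1)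
          have hV0 : 0 ≤ s := hx.trans hs.1.le
          have e1 : c * (U x s : ℝ≥0∞) ^ q * (U x s : ℝ≥0∞) ^ q * (F s ^ r / F s) ≤
              K * divTop (condDensity q r U v ν s) (ν (Ioi s)) := by
            refine le_mul_divTop hK0 (measure_ne_top _ _) (le_trans ?_ hN)
            calc ν (Ioi s) * (c * (U x s : ℝ≥0∞) ^ q * (U x s : ℝ≥0∞) ^ q * (F s ^ r / F s))
                = c * (U x s : ℝ≥0∞) ^ q * F s ^ r *
                  (((U x s : ℝ≥0∞) ^ q * ν (Ioi s)) / F s) := by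
                  simp only [div_eq_mul_inv]; ring
              _ ≤ c * (U x s : ℝ≥0∞) ^ q * F s ^ r * 1 := by
                  gcongr
                  exact ENNReal.div_le_of_le_mul (by
                    rw [one_mul]; exact hU.rpow_mul_measure_le_kernelTail hq0.le ν hx hs.1.le)
              _ = _ := mul_one _
          have e2 : c * (U x s : ℝ≥0∞) ^ q * (F s ^ r / F s) ≤
              K * divTop (condDensity q r U v ν s) (kernelTail q U ν s s) := by
            refine le_mul_divTop hK0 (kernelTail_ne_top hU hq0 hνn hV0 hV0) (le_trans ?_ hN)
            calc kernelTail q U ν s s * (c * (U x s : ℝ≥0∞) ^ q * (F s ^ r / F s))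
                = c * (U x s : ℝ≥0∞) ^ q * F s ^ r * (kernelTail q U ν s s / F s) := by
                  simp only [div_eq_mul_inv]; ring
              _ ≤ c * (U x s : ℝ≥0∞) ^ q * F s ^ r * 1 := by
                  gcongr
                  exact ENNReal.div_le_of_le_mul (by
                    rw [one_mul]
                    exact hU.kernelTail_le_kernelTail hq0.le ν hx hs.1.le le_rfl le_rfl)
              _ = _ := mul_one _
          calc c * (U x t : ℝ≥0∞) ^ q * ((U x s : ℝ≥0∞) ^ q * (F s ^ r / F s))
              ≤ c * ((θ : ℝ≥0∞) ^ q * ((U x s : ℝ≥0∞) ^ q + (U s t : ℝ≥0∞) ^ q)) *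
                ((U x s : ℝ≥0∞) ^ q * (F s ^ r / F s)) := by
                gcongr; exact hU.rpow_triangle hq0.le hq1.le hx hs.1 hs.2
            _ = (θ : ℝ≥0∞) ^ q * (c * (U x s : ℝ≥0∞) ^ q * (U x s : ℝ≥0∞) ^ q * (F s ^ r / F s) +
                c * (U x s : ℝ≥0∞) ^ q * (F s ^ r / F s) * (U s t : ℝ≥0∞) ^ q) := by ring
            _ ≤ (θ : ℝ≥0∞) ^ q * (K * divTop (condDensity q r U v ν s) (ν (Ioi s)) +
                K * divTop (condDensity q r U v ν s) (kernelTail q U ν s s) *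
                  (U s t : ℝ≥0∞) ^ q) := by gcongr
            _ = _ := by ring
      _ = (θ : ℝ≥0∞) ^ q * (K * ∫⁻ s in Ioo x t,
            (divTop (condDensity q r U v ν s) (ν (Ioi s)) +
            divTop (condDensity q r U v ν s) (kernelTail q U ν s s) * (U s t : ℝ≥0∞) ^ q) ∂ν) := by
          rw [lintegral_const_mul' _ _
            (ENNReal.rpow_ne_top_of_nonneg hq0.le ENNReal.coe_ne_top), lintegral_const_mul']
          refine ENNReal.mul_ne_top (ENNReal.rpow_ne_top_of_nonneg hq0.le
            (ENNReal.rpow_ne_top_of_nonneg hr0.le ENNReal.coe_ne_top))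
            (ENNReal.rpow_ne_top_of_nonneg hr0.le (by simp))
      _ ≤ _ := by
          gcongr
          refine le_trans (lintegral_mono_set Ioo_subset_Iio_self) ?_
          exact le_add_self
  have hsecond : c * (U x t : ℝ≥0∞) ^ q * F t ^ r ≤ K * auxWeight q r U v ν t :=
    (kernelTail_rpow_le_condDensity hU hq0 hq1 hr hx hxt hSt hRt).trans
      (by gcongr; exact le_self_add)
  calc c * (U x t : ℝ≥0∞) ^ q * F x ^ r
      ≤ c * (U x t : ℝ≥0∞) ^ q * (2 ^ r * (2 * ∫⁻ s in Ioo x t, (U x s : ℝ≥0∞) ^ q *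
      (F s ^ r / F s) ∂ν + F t ^ r)) := by
        gcongr; exact kernelTail_rpow_le_lintegral hU hq0 hr0 hν hνn hx hxt.le
    _ = 2 ^ r * (2 * (c * (U x t : ℝ≥0∞) ^ q * ∫⁻ s in Ioo x t, (U x s : ℝ≥0∞) ^ q *
      (F s ^ r / F s) ∂ν) + c * (U x t : ℝ≥0∞) ^ q * F t ^ r) := by ring
    _ ≤ 2 ^ r * (2 * ((θ : ℝ≥0∞) ^ q * (K * auxWeight q r U v ν t)) +
          K * auxWeight q r U v ν t) := by gcongr
    _ = _ := by ring

end Sufficiency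

/-! ### Sufficiency: Hölder's inequality against the auxiliary weight -/

section Sufficiency

variable {q r : ℝ} {θ : ℝ≥0} {U : ℝ → ℝ → ℝ≥0} {v : ℝ → ℝ≥0∞} {ν : Measure ℝ}

/-- Since q/r = 1 - q, the hypothesis raised to the power 1/r reads a^{-1} u^{1-q} F ≤ K^{1/r}
H^{1/r}; multiplication by u^q gives the claim. The case distinctions treat zero and infinite
values. -/
theorem ENNReal.mul_rpow_neg_le_of_rpow_le (hq0 : 0 < q) (hq1 : q < 1) (hr : r = q / (1 - q))
    {u : ℝ≥0} {a F K H : ℝ≥0∞} (hF0 : F ≠ 0) (hF : F ≠ ∞) (hK0 : K ≠ 0) (hK : K ≠ ∞)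
    (hH0 : H ≠ 0) (h : a ^ (-r) * (u : ℝ≥0∞) ^ q * F ^ r ≤ K * H) :
    (u : ℝ≥0∞) * H ^ (-(1 / r)) ≤ K ^ (1 / r) * a / F * (u : ℝ≥0∞) ^ q := by
  have h1q : 0 < 1 - q := by linarith
  have hr0 : 0 < r := by rw [hr]; positivity
  have hr' : 0 < 1 / r := by positivity
  have h1 := ENNReal.rpow_le_rpow h hr'.le
  rw [ENNReal.mul_rpow_of_nonneg _ _ hr'.le, ENNReal.mul_rpow_of_nonneg _ _ hr'.le,
    ENNReal.mul_rpow_of_nonneg _ _ hr'.le, ← ENNReal.rpow_mul, ← ENNReal.rpow_mul,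
    ← ENNReal.rpow_mul, show -r * (1 / r) = -1 by field_simp, show r * (1 / r) = 1 by field_simp,
    show q * (1 / r) = 1 - q by rw [hr]; field_simp, ENNReal.rpow_one, ENNReal.rpow_neg_one] at h1
  rw [ENNReal.rpow_neg]
  set k := K ^ (1 / r) with hk
  set η := H ^ (1 / r) with hη
  set y := (u : ℝ≥0∞) ^ (1 - q) with hy
  have huy : (u : ℝ≥0∞) = y * (u : ℝ≥0∞) ^ q := by
    rw [hy, ← ENNReal.rpow_add_of_nonneg _ _ h1q.le hq0.le]; simp
  have hk0 : k ≠ 0 := by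
    rw [hk, Ne, ENNReal.rpow_eq_zero_iff]; simp [hK0, hK]
  have hktop : k ≠ ∞ := ENNReal.rpow_ne_top_of_nonneg hr'.le hK
  have hη0 : η ≠ 0 := by
    rw [hη, Ne, ENNReal.rpow_eq_zero_iff]; simp [hH0, hr0.le]
  suffices y * η⁻¹ ≤ k * a / F by
    calc (u : ℝ≥0∞) * η⁻¹ = y * η⁻¹ * (u : ℝ≥0∞) ^ q := by
          conv_lhs => rw [huy]
          ring
      _ ≤ _ := by gcongr
  by_cases hy0 : y = 0
  · simp [hy0]
  by_cases hηt : η = ∞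
  · simp [hηt]
  by_cases ha0 : a = 0
  · exfalso
    rw [ha0, ENNReal.inv_zero, ENNReal.top_mul hy0, ENNReal.top_mul hF0, top_le_iff] at h1
    exact ENNReal.mul_ne_top hktop hηt h1
  by_cases hat : a = ∞
  · rw [hat, ENNReal.mul_top hk0, ENNReal.top_div_of_ne_top hF]; exact le_top
  rw [ENNReal.le_div_iff_mul_le (Or.inl hF0) (Or.inl hF)]
  calc y * η⁻¹ * F = (a⁻¹ * y * F) * (a * η⁻¹) := by
        have : a⁻¹ * a = 1 := ENNReal.inv_mul_cancel ha0 hat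
        calc y * η⁻¹ * F = 1 * (y * η⁻¹ * F) := (one_mul _).symm
          _ = _ := by rw [← this]; ring
    _ ≤ (k * η) * (a * η⁻¹) := by gcongr
    _ = k * a * (η * η⁻¹) := by ring
    _ = k * a := by rw [ENNReal.mul_inv_cancel hη0 hηt, mul_one]

/-- The pointwise bound replaces the integrand by K^{1/r} v(x) U(x,t)^q / F, where F is the integral
of U(x,·)^q over (x,∞), so F cancels. -/
theorem lintegral_kernel_mul_le (hU : IsRegularKernel θ U) (hq0 : 0 < q)
    (hq1 : q < 1) (hr : r = q / (1 - q)) [IsFiniteMeasure ν]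
    (hν : ν ≪ volume.restrict (Ioi (0 : ℝ))) {n : ℝ} (hνn : ν (Ioi n) = 0) {x : ℝ} (hx : 0 ≤ x)
    {K : ℝ≥0∞} (hK0 : K ≠ 0) (hK : K ≠ ∞) {H : ℝ → ℝ≥0∞} (hH0 : ∀ t, H t ≠ 0)
    (h : ∀ᵐ t ∂ν, x < t →
      v x ^ (-r) * (U x t : ℝ≥0∞) ^ q * kernelTail q U ν x x ^ r ≤ K * H t) :
    ∫⁻ t in Ioi x, (U x t : ℝ≥0∞) * H t ^ (-(1 / r)) ∂ν ≤ K ^ (1 / r) * v x := by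
  have hUm : AEMeasurable (fun s => (U x s : ℝ≥0∞) ^ q) ν :=
    (hU.aemeasurable_right hν hx).pow_const q
  have hFt : kernelTail q U ν x x ≠ ∞ := kernelTail_ne_top hU hq0 hνn hx hx
  by_cases hF0 : kernelTail q U ν x x = 0
  · have h0 := (lintegral_eq_zero_iff' hUm.restrict).1 hF0
    refine le_trans (le_of_eq ?_) zero_le
    rw [← lintegral_zero (μ := ν.restrict (Ioi x))]
    refine lintegral_congr_ae ?_
    filter_upwards [h0] with t ht
    have : (U x t : ℝ≥0∞) = 0 := by
      simpa [ENNReal.rpow_eq_zero_iff, hq0, hq0.not_gt] using ht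
    rw [this, zero_mul]
  calc ∫⁻ t in Ioi x, (U x t : ℝ≥0∞) * H t ^ (-(1 / r)) ∂ν
      ≤ ∫⁻ t in Ioi x, K ^ (1 / r) * v x / kernelTail q U ν x x * (U x t : ℝ≥0∞) ^ q ∂ν := by
        refine lintegral_mono_ae ?_
        filter_upwards [ae_restrict_of_ae h, ae_restrict_mem measurableSet_Ioi] with t ht htx
        exact ENNReal.mul_rpow_neg_le_of_rpow_le hq0 hq1 hr hF0 hFt hK0 hK (hH0 t) (ht htx)
    _ = K ^ (1 / r) * v x / kernelTail q U ν x x * kernelTail q U ν x x := by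
        rw [lintegral_const_mul'' _ hUm.restrict]; rfl
    _ ≤ _ := by rw [mul_comm]; exact ENNReal.mul_div_le

theorem hardyOp_monotoneOn (hU : IsRegularKernel θ U) (f : ℝ → ℝ≥0∞) :
    MonotoneOn (hardyOp U f) (Ioi 0) := by
  intro s hs t _ hst
  unfold hardyOp
  refine le_trans (setLIntegral_mono' measurableSet_Ioo fun x hx => ?_)
    (lintegral_mono_set (Ioo_subset_Ioo_right hst))
  gcongr
  exact hU.le_right hx.1.le (le_of_lt hs) hst

theorem aemeasurable_hardyOp (hU : IsRegularKernel θ U)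
    (hν : ν ≪ volume.restrict (Ioi (0 : ℝ))) (f : ℝ → ℝ≥0∞) : AEMeasurable (hardyOp U f) ν :=
  (aemeasurable_restrict_of_monotoneOn measurableSet_Ioi (hardyOp_monotoneOn hU f)).mono_ac hν

theorem lintegral_hardyOp_mul (hU : IsRegularKernel θ U) [SFinite ν]
    (hν : ν ≪ volume.restrict (Ioi (0 : ℝ))) {f φ : ℝ → ℝ≥0∞} (hf : NonnegMeasurable f)
    (hφ : AEMeasurable φ ν) :
    ∫⁻ t, hardyOp U f t * φ t ∂ν =
      ∫⁻ x in Ioi 0, f x * ∫⁻ t in Ioi x, (U x t : ℝ≥0∞) * φ t ∂ν := by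
  set μ := volume.restrict (Ioi (0 : ℝ)) with hμ
  have hm : AEMeasurable (Function.uncurry fun x t => (Ioi x).indicator
      (fun t => f x * ((U x t : ℝ≥0∞) * φ t)) t) (μ.prod ν) := by
    have h1 : AEMeasurable (fun p : ℝ × ℝ => f p.1 * ((U p.1 p.2 : ℝ≥0∞) * φ p.2)) (μ.prod ν) :=
      (AEMeasurable.comp_quasiMeasurePreserving hf Measure.quasiMeasurePreserving_fst).mul
        ((hU.aemeasurable_prod Measure.AbsolutelyContinuous.rfl hν).mul
          (hφ.comp_quasiMeasurePreserving Measure.quasiMeasurePreserving_snd))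
    refine (h1.indicator (measurableSet_lt measurable_fst measurable_snd)).congr
      (Filter.Eventually.of_forall ?_)
    rintro ⟨x, t⟩
    simp only [Function.uncurry, indicator]
    rfl
  have h2 := lintegral_lintegral_swap hm
  calc ∫⁻ t, hardyOp U f t * φ t ∂ν
      = ∫⁻ t, ∫⁻ x, (Ioi x).indicator (fun t => f x * ((U x t : ℝ≥0∞) * φ t)) t ∂μ ∂ν := by
        have hpos : ∀ᵐ s ∂ν, 0 < s := hν.ae_le (ae_restrict_mem measurableSet_Ioi)
        refine lintegral_congr_ae ?_
        filter_upwards [hpos] with t ht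
        have hfU : AEMeasurable (fun x => f x * (U x t : ℝ≥0∞)) (volume.restrict (Ioo 0 t)) :=
          (AEMeasurable.mul hf (hU.aemeasurable_left ht.le)).mono_measure
            (Measure.restrict_mono Ioo_subset_Ioi_self le_rfl)
        rw [hardyOp, ← lintegral_mul_const'' _ hfU]
        have : Ioo 0 t = Iio t ∩ Ioi 0 := by ext z; simp [and_comm]
        rw [this, ← Measure.restrict_restrict measurableSet_Iio,
          ← lintegral_indicator measurableSet_Iio]
        refine lintegral_congr fun x => ?_
        simp only [indicator, mem_Iio, mem_Ioi, mul_assoc]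
    _ = ∫⁻ x, ∫⁻ t, (Ioi x).indicator (fun t => f x * ((U x t : ℝ≥0∞) * φ t)) t ∂ν ∂μ := h2.symm
    _ = _ := by
        refine setLIntegral_congr_fun measurableSet_Ioi fun x hx => ?_
        rw [lintegral_indicator measurableSet_Ioi, lintegral_const_mul'']
        exact ((hU.aemeasurable_right hν (le_of_lt hx)).mul hφ).restrict

/-- The constant of the sufficiency part. -/
noncomputable def suffConst (q r : ℝ) (θ : ℝ≥0) : ℝ≥0∞ :=
  2 ^ r * (((θ : ℝ≥0∞) ^ r) ^ q * 2 ^ r) * (2 * (θ : ℝ≥0∞) ^ q + 1)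

theorem suffConst_ne (hθ : 0 < θ) (hq0 : 0 < q) (hr0 : 0 < r) :
    suffConst q r θ ≠ 0 ∧ suffConst q r θ ≠ ∞ := by
  unfold suffConst
  have h2 : (2 : ℝ≥0∞) ^ r ≠ 0 := by simp [ENNReal.rpow_eq_zero_iff]
  have h2' : (2 : ℝ≥0∞) ^ r ≠ ∞ := ENNReal.rpow_ne_top_of_nonneg hr0.le (by simp)
  have h3 : ((θ : ℝ≥0∞) ^ r) ^ q ≠ 0 := by
    simp [ENNReal.rpow_eq_zero_iff, hθ.ne', hq0.not_gt, hr0.not_gt]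
  have h3' : ((θ : ℝ≥0∞) ^ r) ^ q ≠ ∞ := ENNReal.rpow_ne_top_of_nonneg hq0.le
    (ENNReal.rpow_ne_top_of_nonneg hr0.le ENNReal.coe_ne_top)
  have h4 : (θ : ℝ≥0∞) ^ q ≠ ∞ := ENNReal.rpow_ne_top_of_nonneg hq0.le ENNReal.coe_ne_top
  exact ⟨mul_ne_zero (mul_ne_zero h2 (mul_ne_zero h3 h2)) (by simp),
    ENNReal.mul_ne_top (ENNReal.mul_ne_top h2' (ENNReal.mul_ne_top h3' h2'))
      (by simp [ENNReal.mul_eq_top, h4])⟩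

/-- Hölder's inequality with exponents 1/q and 1/(1-q) for h^q = (h H^{-1/r})^q H^{1-q}, valid as
q/r = 1 - q. -/
theorem lintegral_rpow_le_of_weight (hq0 : 0 < q) (hq1 : q < 1) (hr : r = q / (1 - q))
    {h H : ℝ → ℝ≥0∞} (hh : AEMeasurable h ν) (hH : AEMeasurable H ν) (hH0 : ∀ t, H t ≠ 0)
    (hHt : ∫⁻ t, H t ∂ν ≠ ∞) :
    ∫⁻ t, h t ^ q ∂ν ≤ (∫⁻ t, h t * H t ^ (-(1 / r)) ∂ν) ^ q * (∫⁻ t, H t ∂ν) ^ (1 - q) := by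
  have h1q : 0 < 1 - q := by linarith
  have hconj : (1 / q).HolderConjugate (1 / (1 - q)) := by
    rw [Real.holderConjugate_iff]
    exact ⟨by rw [lt_div_iff₀ hq0]; linarith, by simp⟩
  have key := ENNReal.lintegral_mul_le_Lp_mul_Lq ν hconj
    (f := fun t => (h t * H t ^ (-(1 / r))) ^ q) (g := fun t => H t ^ (1 - q))
    ((hh.mul (hH.pow_const _)).pow_const q) (hH.pow_const _)
  simp only [Pi.mul_apply, ← ENNReal.rpow_mul, one_div_one_div] at key
  rw [show q * (1 / q) = 1 by field_simp, show (1 - q) * (1 / (1 - q)) = 1 by field_simp] at key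
  simp only [ENNReal.rpow_one] at key
  refine le_trans (lintegral_mono_ae ?_) key
  filter_upwards [ae_lt_top' hH hHt] with t ht
  have e : (-(1 / r)) * q = -(1 - q) := by rw [hr]; field_simp
  rw [ENNReal.mul_rpow_of_nonneg _ _ hq0.le, ← ENNReal.rpow_mul, e, mul_assoc,
    ← ENNReal.rpow_add _ _ (hH0 t) ht.ne]
  simp

theorem lintegral_hardyOp_rpow_le (hU : IsRegularKernel θ U) (hθ : 0 < θ) (hq0 : 0 < q)
    (hq1 : q < 1) (hr : r = q / (1 - q)) (hv : NonnegMeasurable v) [IsFiniteMeasure ν]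
    (hν : ν ≪ volume.restrict (Ioi (0 : ℝ))) {n : ℝ} (hνn : ν (Ioi n) = 0)
    {A : ℝ≥0∞} (hA : 3 * ∫⁻ t, condDensity q r U v ν t ∂ν < A) (hAt : A ≠ ∞)
    {f : ℝ → ℝ≥0∞} (hf : NonnegMeasurable f) :
    ∫⁻ t, hardyOp U f t ^ q ∂ν ≤
      (suffConst q r θ ^ (1 / r) * ∫⁻ x in Ioi 0, f x * v x) ^ q * A ^ (1 - q) := by
  have h1q : 0 < 1 - q := by linarith
  have hr0 : 0 < r := by rw [hr]; positivity
  obtain ⟨hK0, hK⟩ := suffConst_ne hθ hq0 hr0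
  set K := suffConst q r θ with hKdef
  -- The constant δ keeps H positive, as its negative power requires; the gap in `hA` and the
  -- finiteness of ν pay for its integral.
  obtain ⟨δ, hδ0, hδ⟩ : ∃ δ : ℝ≥0∞, δ ≠ 0 ∧
      3 * ∫⁻ t, condDensity q r U v ν t ∂ν + δ * ν univ ≤ A := by
    refine ⟨(A - 3 * ∫⁻ t, condDensity q r U v ν t ∂ν) / (ν univ + 1), ?_, ?_⟩
    · exact (ENNReal.div_pos (tsub_pos_of_lt hA).ne' (by simp)).ne'
    · calc _ ≤ 3 * ∫⁻ t, condDensity q r U v ν t ∂ν +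
          (A - 3 * ∫⁻ t, condDensity q r U v ν t ∂ν) / (ν univ + 1) * (ν univ + 1) := by
            gcongr; exact le_self_add
        _ ≤ 3 * ∫⁻ t, condDensity q r U v ν t ∂ν +
          (A - 3 * ∫⁻ t, condDensity q r U v ν t ∂ν) := by
            gcongr; rw [mul_comm]; exact ENNReal.mul_div_le
        _ = A := add_tsub_cancel_of_le hA.le
  set H : ℝ → ℝ≥0∞ := fun t => auxWeight q r U v ν t + δ with hHdef
  have hG := aemeasurable_auxWeight (v := v) hU hq0.le hr0.le hν
  have hHm : AEMeasurable H ν := hG.add_const δ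
  have hH0 : ∀ t, H t ≠ 0 := fun t => by simp [hHdef, hδ0]
  have hHA : ∫⁻ t, H t ∂ν ≤ A := by
    rw [hHdef, lintegral_add_right _ measurable_const, lintegral_const]
    exact le_trans (by gcongr; exact lintegral_auxWeight_le hU hq0.le hr0.le hν) hδ
  refine (lintegral_rpow_le_of_weight hq0 hq1 hr (aemeasurable_hardyOp hU hν f) hHm hH0
    (ne_top_of_le_ne_top hAt hHA)).trans ?_
  gcongr
  rw [lintegral_hardyOp_mul hU hν hf (hHm.pow_const _),
    ← lintegral_const_mul' _ _ (ENNReal.rpow_ne_top_of_nonneg (by positivity) hK)]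
  refine lintegral_mono_ae ?_
  filter_upwards [hU.ae_ae_le_kernelSup hr0.le r hv hν, hU.ae_ae_le_kernelSup hq0.le r hv hν,
    ae_restrict_mem measurableSet_Ioi] with x hS hR hx
  calc f x * ∫⁻ t in Ioi x, (U x t : ℝ≥0∞) * H t ^ (-(1 / r)) ∂ν
      ≤ f x * (K ^ (1 / r) * v x) := by
        gcongr
        refine lintegral_kernel_mul_le hU hq0 hq1 hr hν hνn (le_of_lt hx) hK0 hK hH0 ?_
        filter_upwards [hS, hR] with t hSt hRt hxt
        refine (rpow_mul_kernelTail_le_auxWeight hU hθ hq0 hq1 hr hν hνn (le_of_lt hx) hxt hS hR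
          (hSt hxt) (hRt hxt)).trans ?_
        rw [hKdef, suffConst]
        gcongr
        exact le_self_add
    _ = _ := by ring

end Sufficiency

/-- The measure `w dt` on `(0,∞)`. -/
noncomputable def weightMeasure (w : ℝ → ℝ≥0∞) : Measure ℝ :=
  (volume.restrict (Ioi (0 : ℝ))).withDensity w

/-! ### From ν to w dt: the upper bound for the best constant -/

section WeightMeasure

variable {q r : ℝ} {θ : ℝ≥0} {U : ℝ → ℝ → ℝ≥0} {v w : ℝ → ℝ≥0∞}

theorem weightMeasure_absolutelyContinuous (w : ℝ → ℝ≥0∞) :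
    weightMeasure w ≪ volume.restrict (Ioi (0 : ℝ)) :=
  withDensity_absolutelyContinuous _ _

theorem lintegral_weightMeasure (hw : NonnegMeasurable w) {g : ℝ → ℝ≥0∞}
    (hg : AEMeasurable g (weightMeasure w)) :
    ∫⁻ t, g t ∂(weightMeasure w) = ∫⁻ t in Ioi 0, w t * g t :=
  lintegral_withDensity_eq_lintegral_mul₀' hw hg

theorem setLIntegral_weightMeasure (hw : NonnegMeasurable w) {g : ℝ → ℝ≥0∞}
    (hg : AEMeasurable g (weightMeasure w)) {s : Set ℝ} (hs : MeasurableSet s) (h0 : s ⊆ Ioi 0) :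
    ∫⁻ t in s, g t ∂(weightMeasure w) = ∫⁻ t in s, w t * g t := by
  rw [← lintegral_indicator hs, lintegral_weightMeasure hw (hg.indicator hs)]
  have : ∀ t, w t * s.indicator g t = s.indicator (fun t => w t * g t) t := fun t => by
    by_cases h : t ∈ s <;> simp [h]
  simp_rw [this]
  rw [lintegral_indicator hs, Measure.restrict_restrict hs, inter_eq_left.2 h0]

theorem weightMeasure_apply (w : ℝ → ℝ≥0∞) {s : Set ℝ} (hs : MeasurableSet s) (h0 : s ⊆ Ioi 0) :
    weightMeasure w s = ∫⁻ t in s, w t := by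
  rw [weightMeasure, withDensity_apply _ hs, Measure.restrict_restrict hs, inter_eq_left.2 h0]

theorem weightMeasure_Iio_lt_top (hw : IsWeight w) (n : ℝ) : weightMeasure w (Iio n) < ∞ := by
  rw [weightMeasure, withDensity_apply _ measurableSet_Iio,
    Measure.restrict_restrict measurableSet_Iio]
  refine lt_of_le_of_lt (lintegral_mono_set (fun x hx => ?_)) (hw.2 (max n 1) (by simp)).2
  exact ⟨hx.2, lt_of_lt_of_le hx.1 (le_max_left _ _)⟩

theorem A3star_add_A4star (hU : IsRegularKernel θ U) (hq0 : 0 < q) (hq1 : q < 1)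
    (hr : r = q / (1 - q)) (hw : NonnegMeasurable w) :
    A3star q U v w + A4star q U v w =
      ∫⁻ t, condDensity q r U v (weightMeasure w) t ∂(weightMeasure w) := by
  have h1q : 0 < 1 - q := by linarith
  have hr0 : 0 < r := by rw [hr]; positivity
  have hq' : conjExp q = -r := by
    rw [conjExp, hr, ← neg_sub 1 q, div_neg]
  have hac := weightMeasure_absolutelyContinuous w
  have hS : AEMeasurable (fun t => (weightMeasure w) (Ioi t) ^ r * kernelSup r r U v t)
      (weightMeasure w) :=
    ((measurable_measure_Ioi _).pow_const r).aemeasurable.mul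
      (hU.kernelSup_mono hr0.le r v).measurable.aemeasurable
  have hV := (hU.aemeasurable_condDensity hq0.le hr0.le v hac).2
  have hR : AEMeasurable (fun t => kernelTail q U (weightMeasure w) t t ^ r *
      kernelSup q r U v t) (weightMeasure w) :=
    (hV.pow_const r).mul (hU.kernelSup_mono hq0.le r v).measurable.aemeasurable
  unfold condDensity
  rw [lintegral_add_left' hS, lintegral_weightMeasure hw hS, lintegral_weightMeasure hw hR,
    A3star, A4star, hq', neg_neg]
  congr 1
  · refine setLIntegral_congr_fun measurableSet_Ioi fun t ht => ?_
    simp only [kernelSup]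
    rw [weightMeasure_apply w measurableSet_Ioi (Ioi_subset_Ioi (le_of_lt ht))]
    ring
  · refine setLIntegral_congr_fun measurableSet_Ioi fun t ht => ?_
    simp only [kernelSup, kernelTail]
    rw [setLIntegral_weightMeasure hw ((hU.aemeasurable_right hac (le_of_lt ht)).pow_const q)
      measurableSet_Ioi (Ioi_subset_Ioi (le_of_lt ht))]
    ring

theorem weightedNorm_hardyOp (hU : IsRegularKernel θ U) (hw : NonnegMeasurable w)
    (f : ℝ → ℝ≥0∞) :
    weightedNorm q w (hardyOp U f) =
      (∫⁻ t, hardyOp U f t ^ q ∂(weightMeasure w)) ^ (1 / q) := by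
  rw [lintegral_weightMeasure hw
    ((aemeasurable_hardyOp hU (weightMeasure_absolutelyContinuous w) f).pow_const q), weightedNorm]
  simp_rw [mul_comm]

theorem weightedNorm_one (v f : ℝ → ℝ≥0∞) : weightedNorm 1 v f = ∫⁻ t in Ioi 0, f t * v t := by
  simp [weightedNorm]

theorem condDensity_mono_measure (hr0 : 0 ≤ r) {ν ν' : Measure ℝ} (h : ν ≤ ν') (t : ℝ) :
    condDensity q r U v ν t ≤ condDensity q r U v ν' t := by
  unfold condDensity kernelTail
  gcongr

theorem hardyInequality_of_lt (hU : IsRegularKernel θ U) (hθ : 0 < θ) (hq0 : 0 < q)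
    (hq1 : q < 1) (hr : r = q / (1 - q)) (hv : IsWeight v) (hw : IsWeight w)
    {A : ℝ≥0∞} (hA : 3 * (A3star q U v w + A4star q U v w) < A) (hAt : A ≠ ∞) :
    HardyInequality 1 q U v w ((suffConst q r θ * A) ^ (1 / r)).toNNReal := by
  have h1q : 0 < 1 - q := by linarith
  have hr0 : 0 < r := by rw [hr]; positivity
  obtain ⟨hK0, hK⟩ := suffConst_ne hθ hq0 hr0
  rw [A3star_add_A4star hU hq0 hq1 hr hw.1] at hA
  intro f hf
  rw [ENNReal.coe_toNNReal (ENNReal.rpow_ne_top_of_nonneg (by positivity)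
    (ENNReal.mul_ne_top hK hAt)), weightedNorm_hardyOp hU hw.1, weightedNorm_one]
  have hac := weightMeasure_absolutelyContinuous w
  set ν := weightMeasure w with hν
  set X := ∫⁻ x in Ioi 0, f x * v x with hX
  have hbound : ∫⁻ t, hardyOp U f t ^ q ∂ν ≤
      (suffConst q r θ ^ (1 / r) * X) ^ q * A ^ (1 - q) := by
    -- Restriction to (-∞,n) makes the measure and its kernel tails finite and only decreases the
    -- condition, so the bound is uniform in n.
    have huniv : (⋃ n : ℕ, Iio (n : ℝ)) = univ := by
      ext x; simpa using exists_nat_gt x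
    rw [← setLIntegral_univ, ← huniv, setLIntegral_iUnion_of_directed]
    · refine iSup_le fun n => ?_
      have : IsFiniteMeasure (ν.restrict (Iio (n : ℝ))) := ⟨by
        rw [Measure.restrict_apply_univ]; exact weightMeasure_Iio_lt_top hw n⟩
      refine lintegral_hardyOp_rpow_le hU hθ hq0 hq1 hr hv.1
        (Measure.restrict_le_self.absolutelyContinuous.trans hac) (n := n) ?_ ?_ hAt hf
      · rw [Measure.restrict_apply measurableSet_Ioi]
        have : Ioi (n : ℝ) ∩ Iio (n : ℝ) = ∅ := by
          ext x; simp only [mem_inter_iff, mem_Ioi, mem_Iio, mem_empty_iff_false, iff_false]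
          intro h; exact lt_asymm h.1 h.2
        rw [this, measure_empty]
      · refine lt_of_le_of_lt ?_ hA
        gcongr 3 * ?_
        exact lintegral_mono' Measure.restrict_le_self fun t =>
          condDensity_mono_measure hr0.le Measure.restrict_le_self t
    · exact Monotone.directed_le fun m n h => Iio_subset_Iio (by exact_mod_cast h)
  calc (∫⁻ t, hardyOp U f t ^ q ∂ν) ^ (1 / q)
      ≤ ((suffConst q r θ ^ (1 / r) * X) ^ q * A ^ (1 - q)) ^ (1 / q) :=
        ENNReal.rpow_le_rpow hbound (by positivity)
    _ = (suffConst q r θ * A) ^ (1 / r) * X := by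
        rw [ENNReal.mul_rpow_of_nonneg _ _ (by positivity : 0 ≤ 1 / q), ← ENNReal.rpow_mul,
          ← ENNReal.rpow_mul, show q * (1 / q) = 1 by field_simp,
          show (1 - q) * (1 / q) = 1 / r by rw [hr]; field_simp, ENNReal.rpow_one,
          ENNReal.mul_rpow_of_nonneg _ _ (by positivity : 0 ≤ 1 / r)]
        ring

/-- Letting A decrease to 3(A₃* + A₄*) removes the strict inequality of `hardyInequality_of_lt`. -/
theorem hardyConst_rpow_le (hU : IsRegularKernel θ U) (hθ : 0 < θ) (hq0 : 0 < q)
    (hq1 : q < 1) (hr : r = q / (1 - q)) (hv : IsWeight v) (hw : IsWeight w) :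
    hardyConst 1 q U v w ^ r ≤ suffConst q r θ * 3 * (A3star q U v w + A4star q U v w) := by
  have h1q : 0 < 1 - q := by linarith
  have hr0 : 0 < r := by rw [hr]; positivity
  obtain ⟨hK0, hK⟩ := suffConst_ne hθ hq0 hr0
  rw [mul_assoc, mul_comm, ← ENNReal.div_le_iff_le_mul (Or.inl hK0) (Or.inl hK)]
  refine le_of_forall_gt_imp_ge_of_dense fun A hA => ?_
  by_cases hAt : A = ∞
  · rw [hAt]; exact le_top
  rw [ENNReal.div_le_iff_le_mul (Or.inl hK0) (Or.inl hK), mul_comm]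
  have h := hardyInequality_of_lt hU hθ hq0 hq1 hr hv hw hA hAt
  have h1 : hardyConst 1 q U v w ≤ (suffConst q r θ * A) ^ (1 / r) := by
    refine (iInf₂_le _ h).trans (le_of_eq (ENNReal.coe_toNNReal ?_))
    exact ENNReal.rpow_ne_top_of_nonneg (by positivity) (ENNReal.mul_ne_top hK hAt)
  calc _ ≤ ((suffConst q r θ * A) ^ (1 / r)) ^ r := ENNReal.rpow_le_rpow h1 hr0.le
    _ = _ := by
      rw [← ENNReal.rpow_mul, one_div_mul_cancel hr0.ne', ENNReal.rpow_one]

end WeightMeasure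

/-! ### Necessity: test functions and two discrete inequalities -/

section Necessity

variable {q r : ℝ} {θ : ℝ≥0} {U : ℝ → ℝ → ℝ≥0} {v : ℝ → ℝ≥0∞} {ν : Measure ℝ}

/-- The function is the indicator, normalized by ∫_E v, of the set E in (0,t) where k/v exceeds
a^{1/r}; E is not null because a lies below the essential supremum. -/
theorem exists_test_function (hr : 0 < r) (hv : IsWeight v) {k : ℝ → ℝ≥0∞}
    (hk : NonnegMeasurable k) {t : ℝ} {a : ℝ≥0∞}
    (ha : a < essSup (fun z => k z ^ r * v z ^ (-r)) (volume.restrict (Ioo 0 t))) :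
    ∃ f : ℝ → ℝ≥0∞, NonnegMeasurable f ∧ ∫⁻ x in Ioi 0, f x * v x ≤ 1 ∧
      a ^ (1 / r) ≤ ∫⁻ x in Ioo 0 t, f x * k x := by
  have ht : 0 < t := by
    by_contra h
    rw [Ioo_eq_empty h] at ha
    simp at ha
  have hvt : AEMeasurable v (volume.restrict (Ioo 0 t)) :=
    AEMeasurable.mono_measure hv.1 (Measure.restrict_mono Ioo_subset_Ioi_self le_rfl)
  have hkt : AEMeasurable k (volume.restrict (Ioo 0 t)) :=
    AEMeasurable.mono_measure hk (Measure.restrict_mono Ioo_subset_Ioi_self le_rfl)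
  have hg : AEMeasurable (fun z => k z * (v z)⁻¹) (volume.restrict (Ioo 0 t)) := hkt.mul hvt.inv
  set μ := volume.restrict (Ioo 0 t) with hμ
  set E := Ioo 0 t ∩ {z | a ^ (1 / r) < hg.mk _ z} with hE
  have hEm : MeasurableSet E :=
    measurableSet_Ioo.inter (measurableSet_lt measurable_const hg.measurable_mk)
  have hEt : E ⊆ Ioo 0 t := inter_subset_left
  have hpt : ∀ᵐ z ∂(volume.restrict E), a ^ (1 / r) < k z * (v z)⁻¹ := by
    have h1 := ae_restrict_of_ae_restrict_of_subset hEt hg.ae_eq_mk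
    filter_upwards [h1, ae_restrict_mem hEm] with z hz hzE
    rw [hz]; exact hzE.2
  have hE0 : volume E ≠ 0 := by
    intro h0
    refine absurd ha (not_lt.2 (essSup_le_of_ae_le a ?_))
    have h1 : ∀ᵐ z ∂μ, z ∉ E := ae_restrict_of_ae (measure_eq_zero_iff_ae_notMem.1 h0)
    filter_upwards [h1, hg.ae_eq_mk, ae_restrict_mem measurableSet_Ioo] with z hz hzg hzt
    have h2 : k z * (v z)⁻¹ ≤ a ^ (1 / r) := by
      rw [hzg]; exact not_lt.1 fun h => hz ⟨hzt, h⟩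
    calc k z ^ r * v z ^ (-r) = (k z * (v z)⁻¹) ^ r := by
          rw [ENNReal.mul_rpow_of_nonneg _ _ hr.le, ENNReal.rpow_neg, ENNReal.inv_rpow]
      _ ≤ (a ^ (1 / r)) ^ r := ENNReal.rpow_le_rpow h2 hr.le
      _ = a := by rw [← ENNReal.rpow_mul, one_div_mul_cancel hr.ne', ENNReal.rpow_one]
  set x := ∫⁻ z in E, v z with hx
  have hxt : x ≠ ∞ := ((lintegral_mono_set hEt).trans_lt (hv.2 t ht).2).ne
  have hvE : AEMeasurable v (volume.restrict E) :=
    hvt.mono_measure (Measure.restrict_mono hEt le_rfl)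
  have hkE : AEMeasurable k (volume.restrict E) :=
    hkt.mono_measure (Measure.restrict_mono hEt le_rfl)
  have hind : ∀ (h : ℝ → ℝ≥0∞) (s : Set ℝ), MeasurableSet s → E ⊆ s →
      AEMeasurable h (volume.restrict E) →
      ∫⁻ z in s, E.indicator (fun _ => x⁻¹) z * h z = x⁻¹ * ∫⁻ z in E, h z := by
    intro h s hs hEs hh
    have : ∀ z, E.indicator (fun _ => x⁻¹) z * h z = E.indicator (fun z => x⁻¹ * h z) z := fun z => by
      by_cases hz : z ∈ E <;> simp [hz]
    simp_rw [this]
    rw [lintegral_indicator hEm, Measure.restrict_restrict hEm, inter_eq_left.2 hEs,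
      lintegral_const_mul'' _ hh]
  refine ⟨E.indicator fun _ => x⁻¹, (measurable_const.indicator hEm).aemeasurable, ?_, ?_⟩
  · rw [hind v _ measurableSet_Ioi (hEt.trans Ioo_subset_Ioi_self) hvE]
    exact ENNReal.inv_mul_le_one x
  · rw [hind k _ measurableSet_Ioo hEt hkE]
    -- If ∫_E v = 0, the function is ∞ on E at no cost; k is positive a.e. on E, so the right side
    -- is ∞.
    by_cases hx0 : x = 0
    · have hpos : ∫⁻ z in E, k z ≠ 0 := by
        intro h0
        have h1 := (lintegral_eq_zero_iff' hkE).1 h0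
        have h2 : ∀ᵐ z ∂(volume.restrict E), False := by
          filter_upwards [h1, hpt] with z hz hz2
          rw [hz] at hz2
          simp at hz2
        have h3 := ae_iff.1 h2
        simp at h3
        exact hE0 h3
      rw [hx0, ENNReal.inv_zero, ENNReal.top_mul hpos]
      exact le_top
    · calc a ^ (1 / r) = x⁻¹ * (a ^ (1 / r) * x) := by
            rw [mul_left_comm, ENNReal.inv_mul_cancel hx0 hxt, mul_one]
        _ ≤ _ := by
            gcongr
            rw [hx, ← lintegral_const_mul'' _ hvE]
            refine lintegral_mono_ae ?_
            filter_upwards [hpt] with z hz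
            calc a ^ (1 / r) * v z ≤ k z * (v z)⁻¹ * v z := by gcongr
              _ = k z * ((v z)⁻¹ * v z) := mul_assoc _ _ _
              _ ≤ k z * 1 := by gcongr; exact ENNReal.inv_mul_le_one _
              _ = k z := mul_one _

/-- The function is ∑ c_j f_j with f_j from `exists_test_function`; both sides are linear in f.
Leaving κ free lets one f serve all the kernels U(·,s) with s in [t_i, t_{i+1}). -/
theorem exists_test_sum (hr : 0 < r) (hv : IsWeight v) {k : ℕ → ℝ → ℝ≥0∞}
    (hk : ∀ j, NonnegMeasurable (k j)) {t : ℕ → ℝ} (ht : Monotone t) (c : ℕ → ℝ≥0∞)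
    {a : ℕ → ℝ≥0∞} (ha : ∀ j, a j = 0 ∨
      a j < essSup (fun z => k j z ^ r * v z ^ (-r)) (volume.restrict (Ioo 0 (t j)))) :
    ∃ f : ℝ → ℝ≥0∞, NonnegMeasurable f ∧ ∫⁻ x in Ioi 0, f x * v x ≤ ∑' j, c j ∧
      ∀ (i : ℕ) (κ : ℝ → ℝ≥0∞), NonnegMeasurable κ →
        (∀ j ≤ i, ∀ z ∈ Ioo 0 (t j), k j z ≤ κ z) →
        ∑ j ∈ Finset.range (i + 1), c j * a j ^ (1 / r) ≤ ∫⁻ x in Ioo 0 (t i), f x * κ x := by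
  have hex : ∀ j, ∃ f : ℝ → ℝ≥0∞, NonnegMeasurable f ∧ ∫⁻ x in Ioi 0, f x * v x ≤ 1 ∧
      a j ^ (1 / r) ≤ ∫⁻ x in Ioo 0 (t j), f x * k j x := by
    intro j
    rcases ha j with h | h
    · refine ⟨fun _ => 0, aemeasurable_const, by simp, ?_⟩
      rw [h, ENNReal.zero_rpow_of_pos (by positivity)]
      exact zero_le
    · exact exists_test_function hr hv (hk j) h
  choose f hfm hfv hfa using hex
  have hcf : ∀ j, AEMeasurable (fun x => c j * f j x) (volume.restrict (Ioi (0 : ℝ))) :=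
    fun j => AEMeasurable.const_mul (hfm j) _
  refine ⟨fun x => ∑' j, c j * f j x, AEMeasurable.tsum hcf, ?_, ?_⟩
  · simp_rw [← ENNReal.tsum_mul_right]
    have hcfv : ∀ j, AEMeasurable (fun x => c j * f j x * v x) (volume.restrict (Ioi (0 : ℝ))) :=
      fun j => (hcf j).mul hv.1
    rw [lintegral_tsum hcfv]
    refine ENNReal.tsum_le_tsum fun j => ?_
    simp_rw [mul_assoc]
    have hfvj : AEMeasurable (fun x => f j x * v x) (volume.restrict (Ioi (0 : ℝ))) :=
      AEMeasurable.mul (hfm j) hv.1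
    rw [lintegral_const_mul'' _ hfvj]
    exact mul_le_of_le_one_right' (hfv j)
  · intro i κ hκ hle
    have hres : ∀ {g : ℝ → ℝ≥0∞}, NonnegMeasurable g →
        AEMeasurable g (volume.restrict (Ioo 0 (t i))) := fun h =>
      AEMeasurable.mono_measure h (Measure.restrict_mono Ioo_subset_Ioi_self le_rfl)
    have hfκ : ∀ j, AEMeasurable (fun x => f j x * κ x) (volume.restrict (Ioo 0 (t i))) :=
      fun j => (hres (hfm j)).mul (hres hκ)
    calc ∑ j ∈ Finset.range (i + 1), c j * a j ^ (1 / r)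
        ≤ ∑ j ∈ Finset.range (i + 1), ∫⁻ x in Ioo 0 (t i), c j * (f j x * κ x) := by
          refine Finset.sum_le_sum fun j hj => ?_
          have hji : j ≤ i := Nat.lt_succ_iff.1 (Finset.mem_range.1 hj)
          rw [lintegral_const_mul'' _ (hfκ j)]
          gcongr
          refine (hfa j).trans ?_
          refine le_trans (setLIntegral_mono' measurableSet_Ioo fun x hx => ?_)
            (lintegral_mono_set (Ioo_subset_Ioo_right (ht hji)))
          gcongr
          exact hle j hji x hx
      _ = ∫⁻ x in Ioo 0 (t i), ∑ j ∈ Finset.range (i + 1), c j * (f j x * κ x) :=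
          (lintegral_finsetSum' _ fun j _ =>
            (hfκ j).const_mul _).symm
      _ ≤ _ := by
          refine lintegral_mono fun x => ?_
          simp_rw [← mul_assoc, ← Finset.sum_mul]
          gcongr
          exact ENNReal.sum_le_tsum _

theorem tsum_measure_Ico_mul_le {t : ℕ → ℝ} (ht : Monotone t) {ν : Measure ℝ}
    (hν : ν ≪ volume.restrict (Ioi (0 : ℝ))) {B : ℕ → ℝ≥0∞} {h : ℝ → ℝ≥0∞}
    (hB : ∀ i, ∀ s ∈ Ico (t i) (t (i + 1)), 0 < s → B i ≤ h s) :
    ∑' i, ν (Ico (t i) (t (i + 1))) * B i ≤ ∫⁻ s, h s ∂ν := by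
  have hpos : ∀ᵐ s ∂ν, 0 < s := hν.ae_le (ae_restrict_mem measurableSet_Ioi)
  calc ∑' i, ν (Ico (t i) (t (i + 1))) * B i
      ≤ ∑' i, ∫⁻ s in Ico (t i) (t (i + 1)), h s ∂ν := by
        refine ENNReal.tsum_le_tsum fun i => ?_
        rw [mul_comm, ← setLIntegral_const]
        refine lintegral_mono_ae ?_
        filter_upwards [ae_restrict_of_ae hpos, ae_restrict_mem measurableSet_Ico] with s hs hsi
        exact hB i s hsi hs
    _ = ∫⁻ s in ⋃ i, Ico (t i) (t (i + 1)), h s ∂ν :=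
        (lintegral_iUnion (fun i => measurableSet_Ico) ht.pairwise_disjoint_on_Ico_succ _).symm
    _ ≤ _ := setLIntegral_le_lintegral _ _

/-- The inequality `∫ (H f)^q dν ≤ D (∫ f v)^q` for all nonnegative measurable `f`. -/
def HardyBound (q : ℝ) (U : ℝ → ℝ → ℝ≥0) (v : ℝ → ℝ≥0∞) (ν : Measure ℝ) (D : ℝ≥0∞) : Prop :=
  ∀ f : ℝ → ℝ≥0∞, NonnegMeasurable f →
    ∫⁻ t, hardyOp U f t ^ q ∂ν ≤ D * (∫⁻ x in Ioi 0, f x * v x) ^ q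

/-- For s in [t_i, t_{i+1}) the kernel U(·,s) dominates all U(·,t_j) with j ≤ i, so the masses of
the blocks and the suprema S(t_i) obey a discrete Hardy inequality. This is the discrete form of
A₃*. -/
theorem tsum_mul_kernelSup_le (hU : IsRegularKernel θ U) (hq0 : 0 < q) (hq1 : q < 1)
    (hr : r = q / (1 - q)) (hv : IsWeight v) (hν : ν ≪ volume.restrict (Ioi (0 : ℝ)))
    {D : ℝ≥0∞} (hD : D ≠ ∞) (H : HardyBound q U v ν D) {t : ℕ → ℝ} (ht : Monotone t)
    (ht0 : ∀ j, 0 ≤ t j) :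
    ∑' i, ν (Ico (t i) (t (i + 1))) * tailSum (fun i => ν (Ico (t i) (t (i + 1)))) i ^ r *
      kernelSup r r U v (t i) ≤ 2 * (2 ^ (2 + r) * D) ^ (1 + r) := by
  have h1q : 0 < 1 - q := by linarith
  have hr0 : 0 < r := by rw [hr]; positivity
  refine tsum_le_of_discrete_hardy hq0 hq1 hr
    (fun i j h => hU.kernelSup_mono hr0.le r v (ht h)) hD (fun c a ha => ?_) fun _ => le_rfl
  obtain ⟨f, hf, hfv, hfk⟩ := exists_test_sum hr0 hv (k := fun j z => (U z (t j) : ℝ≥0∞))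
    (fun j => hU.aemeasurable_left (ht0 j)) ht c ha
  refine le_trans (tsum_measure_Ico_mul_le ht hν (fun i s hs hs0 => ?_))
    ((H f hf).trans (by gcongr))
  refine ENNReal.rpow_le_rpow ?_ hq0.le
  refine (hfk i (fun z => (U z s : ℝ≥0∞)) (hU.aemeasurable_left hs0.le) fun j hj z hz => ?_).trans
    (lintegral_mono_set (Ioo_subset_Ioo_right hs.1))
  exact ENNReal.coe_le_coe.2 (hU.le_right hz.1.le (ht0 j) ((ht hj).trans hs.1))

/-- For x < t_i and s in [t_{i+1}, t_{i+2}) one has U(x,s) ≥ U(t_i,t_{i+1}), so Hf(s) dominates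
U(t_i,t_{i+1}) ∫_{(0,t_i)} f. The kernel has left the supremum, hence the exponent 0. -/
theorem tsum_mul_kernelSup_zero_le (hU : IsRegularKernel θ U) (hq0 : 0 < q) (hq1 : q < 1)
    (hr : r = q / (1 - q)) (hv : IsWeight v) (hν : ν ≪ volume.restrict (Ioi (0 : ℝ)))
    {D : ℝ≥0∞} (hD : D ≠ ∞) (H : HardyBound q U v ν D) {t : ℕ → ℝ} (ht : Monotone t)
    (ht0 : ∀ j, 0 ≤ t j) {g : ℕ → ℝ≥0∞} {M : ℝ≥0∞} (hM : M ≠ ∞)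
    (hg : ∀ i, g i ≤ M * (ν (Ico (t (i + 1)) (t (i + 2))) * (U (t i) (t (i + 1)) : ℝ≥0∞) ^ q))
    {e : ℕ → ℝ≥0∞} (he : ∀ j, tailSum e j ≤ tailSum g j) :
    ∑' i, e i * tailSum g i ^ r * kernelSup 0 r U v (t i) ≤
      2 * (2 ^ (2 + r) * (M * D)) ^ (1 + r) := by
  have h1q : 0 < 1 - q := by linarith
  have hr0 : 0 < r := by rw [hr]; positivity
  refine tsum_le_of_discrete_hardy hq0 hq1 hr
    (fun i j h => hU.kernelSup_mono le_rfl r v (ht h)) (ENNReal.mul_ne_top hM hD)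
    (fun c a ha => ?_) he
  obtain ⟨f, hf, hfv, hfk⟩ := exists_test_sum hr0 hv (k := fun _ _ => (1 : ℝ≥0∞))
    (fun j => aemeasurable_const) ht c (a := a) (by simpa [kernelSup] using ha)
  set B : ℕ → ℝ≥0∞ := fun i => ∑ j ∈ Finset.range (i + 1), c j * a j ^ (1 / r) with hB
  have h1 : ∑' i, ν (Ico (t (i + 1)) (t (i + 2))) *
      ((U (t i) (t (i + 1)) : ℝ≥0∞) ^ q * B i ^ q) ≤ D * (∑' j, c j) ^ q := by
    refine le_trans (tsum_measure_Ico_mul_le (t := fun i => t (i + 1))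
      (fun i j h => ht (Nat.succ_le_succ h)) hν (fun i s hs hs0 => ?_))
      ((H f hf).trans (by gcongr))
    rw [← ENNReal.mul_rpow_of_nonneg _ _ hq0.le]
    refine ENNReal.rpow_le_rpow ?_ hq0.le
    have h2 := hfk i (fun _ => 1) aemeasurable_const fun j hj z hz => le_rfl
    have hfm : AEMeasurable f (volume.restrict (Ioo 0 (t i))) :=
      AEMeasurable.mono_measure hf (Measure.restrict_mono Ioo_subset_Ioi_self le_rfl)
    have hts : t i ≤ s := (ht (Nat.le_succ i)).trans hs.1
    calc (U (t i) (t (i + 1)) : ℝ≥0∞) * B i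
        ≤ U (t i) (t (i + 1)) * ∫⁻ x in Ioo 0 (t i), f x * 1 := by gcongr
      _ = ∫⁻ x in Ioo 0 (t i), f x * U (t i) (t (i + 1)) := by
          simp_rw [mul_one]
          rw [lintegral_mul_const'' _ hfm, mul_comm]
      _ ≤ ∫⁻ x in Ioo 0 (t i), f x * U x s := by
          refine setLIntegral_mono' measurableSet_Ioo fun x hx => ?_
          gcongr
          exact (hU.le_left hx.1.le hx.2.le (ht0 _)).trans (hU.le_right hx.1.le (ht0 _) hs.1)
      _ ≤ _ := lintegral_mono_set (Ioo_subset_Ioo_right hts)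
  calc ∑' i, g i * B i ^ q
      ≤ ∑' i, M * (ν (Ico (t (i + 1)) (t (i + 2))) *
        ((U (t i) (t (i + 1)) : ℝ≥0∞) ^ q * B i ^ q)) := by
        refine ENNReal.tsum_le_tsum fun i => ?_
        calc g i * B i ^ q ≤ M * (ν (Ico (t (i + 1)) (t (i + 2))) *
              (U (t i) (t (i + 1)) : ℝ≥0∞) ^ q) * B i ^ q := by gcongr; exact hg i
          _ = _ := by ring
    _ ≤ M * (D * (∑' j, c j) ^ q) := by rw [ENNReal.tsum_mul_left]; gcongr
    _ = _ := by ring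

/-- Otherwise a test function of finite norm has Hf bounded below on (t,∞), a set of infinite
measure. The second supremum follows because U^r v^{-r} and U^q v^{-r} have the same zeros. -/
theorem kernelSup_eq_zero_of_measure_eq_top (hU : IsRegularKernel θ U) (hq0 : 0 < q)
    (hr0 : 0 < r) (hv : IsWeight v)
    {D : ℝ≥0∞} (hD : D ≠ ∞) (H : HardyBound q U v ν D) {t : ℝ} (ht : 0 < t)
    (hT : ν (Ioi t) = ∞) : kernelSup r r U v t = 0 ∧ kernelSup q r U v t = 0 := by
  have hS : kernelSup r r U v t = 0 := by
    by_contra hne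
    obtain ⟨a, ha0, ha⟩ := exists_between (pos_iff_ne_zero.2 hne)
    obtain ⟨f, hf, hfv, hfa⟩ := exists_test_function hr0 hv (hU.aemeasurable_left ht.le) ha
    have h1 : (a ^ (1 / r)) ^ q * ν (Ioi t) ≤ D := by
      calc (a ^ (1 / r)) ^ q * ν (Ioi t) = ∫⁻ s in Ioi t, (a ^ (1 / r)) ^ q ∂ν := by
            rw [setLIntegral_const]
        _ ≤ ∫⁻ s in Ioi t, hardyOp U f s ^ q ∂ν := by
            refine setLIntegral_mono' measurableSet_Ioi fun s hs => ?_
            refine ENNReal.rpow_le_rpow (hfa.trans ?_) hq0.le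
            refine le_trans (setLIntegral_mono' measurableSet_Ioo fun x hx => ?_)
              (lintegral_mono_set (Ioo_subset_Ioo_right (le_of_lt hs)))
            gcongr
            exact hU.le_right hx.1.le ht.le (le_of_lt hs)
        _ ≤ ∫⁻ s, hardyOp U f s ^ q ∂ν := setLIntegral_le_lintegral _ _
        _ ≤ D * (∫⁻ x in Ioi 0, f x * v x) ^ q := H f hf
        _ ≤ D * 1 := by gcongr; exact ENNReal.rpow_le_one hfv hq0.le
        _ = D := mul_one D
    rw [hT, ENNReal.mul_top] at h1
    · exact hD (top_le_iff.1 h1)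
    · rw [← ENNReal.rpow_mul]
      simp only [ne_eq, ENNReal.rpow_eq_zero_iff]
      rintro (h | h)
      · exact ha0.ne' h.1
      · exact ha.ne_top h.1
  refine ⟨hS, ?_⟩
  unfold kernelSup at hS ⊢
  rw [ENNReal.essSup_eq_zero_iff] at hS ⊢
  filter_upwards [hS] with z hz
  simp only [Pi.zero_apply, mul_eq_zero, ENNReal.rpow_eq_zero_iff, hr0, hr0.not_gt, hq0,
    hq0.not_gt, and_true, and_false, or_false] at hz ⊢
  exact hz

end Necessity

/-! ### Geometric partitions -/

/-- A partition of `(0,∞)` along which the tails of `ν` decrease geometrically with ratio `Θ`. -/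
structure IsGeometricPartition (ν : Measure ℝ) (Θ : ℝ≥0∞) (t : ℕ → ℝ) : Prop where
  zero : t 0 = 0
  strictMono : StrictMono t
  tail : ∀ k, ν (Ioi (t k)) = Θ * ν (Ioi (t (k + 1)))
  exhaust : ∀ᵐ s ∂ν, ∃ n, s < t n

/-- The tail of ν is continuous and tends to 0, so it attains each value ν(0,∞) Θ^{-k}. The points
may accumulate at a finite place beyond which ν has no mass, hence exhaustion only almost
everywhere. -/
theorem exists_isGeometricPartition (ν : Measure ℝ) [IsFiniteMeasure ν] [NullSingletonClass ν]
    (h0 : ν (Ioi 0) ≠ 0) {Θ : ℝ≥0∞} (hΘ : 2 ≤ Θ) (hΘt : Θ ≠ ∞) :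
    ∃ t, IsGeometricPartition ν Θ t := by
  have hΘ0 : Θ ≠ 0 := fun h => by simp [h] at hΘ
  have hinv : Θ⁻¹ ≤ 2⁻¹ := ENNReal.inv_le_inv.2 hΘ
  have hinv1 : Θ⁻¹ < 1 := lt_of_le_of_lt hinv (by simp)
  set T0 := ν (Ioi 0) with hT0
  have hT0t : T0 ≠ ∞ := measure_ne_top _ _
  have hlim : Filter.Tendsto (fun n : ℕ => ν (Ioi (n : ℝ))) Filter.atTop (nhds 0) := by
    have h := tendsto_measure_iInter_atTop (μ := ν) (s := fun n : ℕ => Ioi (n : ℝ))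
      (fun n => measurableSet_Ioi.nullMeasurableSet)
      (fun m n h => Ioi_subset_Ioi (by exact_mod_cast h)) ⟨0, measure_ne_top _ _⟩
    have he : (⋂ n : ℕ, Ioi (n : ℝ)) = ∅ := by
      ext x
      simp only [mem_iInter, mem_Ioi, mem_empty_iff_false, iff_false, not_forall, not_lt]
      exact exists_nat_ge x
    rw [he, measure_empty] at h
    exact h
  have hex : ∀ k : ℕ, ∃ b : ℝ, 0 ≤ b ∧ ν (Ioi b) = T0 * Θ⁻¹ ^ k := by
    intro k
    have hpos : 0 < T0 * Θ⁻¹ ^ k := by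
      refine pos_iff_ne_zero.2 (mul_ne_zero h0 (pow_ne_zero _ (by simpa using hΘt)))
    obtain ⟨n, hn⟩ := ((hlim.eventually (gt_mem_nhds hpos))).exists
    obtain ⟨b, hb, hbe⟩ := exists_measure_Ioi_eq ν (Nat.cast_nonneg n) hn.le
      (mul_le_of_le_one_right' (pow_le_one₀ zero_le hinv1.le))
    exact ⟨b, hb.1, hbe⟩
  choose b hb0 hb using hex
  set t : ℕ → ℝ := fun k => if k = 0 then 0 else b k with ht
  have htT : ∀ k, ν (Ioi (t k)) = T0 * Θ⁻¹ ^ k := by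
    intro k
    by_cases hk : k = 0
    · simp [ht, hk, hT0]
    · simp [ht, hk, hb]
  have htail : ∀ k, ν (Ioi (t k)) = Θ * ν (Ioi (t (k + 1))) := by
    intro k
    rw [htT, htT, pow_succ, mul_comm Θ, mul_assoc T0, mul_assoc _ Θ⁻¹,
      ENNReal.inv_mul_cancel hΘ0 hΘt, mul_one]
  refine ⟨t, by simp [ht], strictMono_nat_of_lt_succ fun k => ?_, htail, ?_⟩
  · by_contra hle
    have h1 : ν (Ioi (t k)) ≤ ν (Ioi (t (k + 1))) := measure_mono (Ioi_subset_Ioi (not_lt.1 hle))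
    rw [htT, htT, pow_succ, ← mul_assoc] at h1
    refine absurd h1 (not_le.2 ?_)
    have hne : T0 * Θ⁻¹ ^ k ≠ 0 := mul_ne_zero h0 (pow_ne_zero _ (by simpa using hΘt))
    have hnt : T0 * Θ⁻¹ ^ k ≠ ∞ := ENNReal.mul_ne_top hT0t (ENNReal.pow_ne_top (by simpa using hΘ0))
    calc T0 * Θ⁻¹ ^ k * Θ⁻¹ < T0 * Θ⁻¹ ^ k * 1 := by
          exact (ENNReal.mul_lt_mul_iff_right hne hnt).2 hinv1
      _ = _ := mul_one _
  · rw [ae_iff]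
    have hle : ∀ n, ν {s | ¬ ∃ n, s < t n} ≤ T0 * Θ⁻¹ ^ n := by
      intro n
      rw [← htT, ← measure_congr (Ioi_ae_eq_Ici (μ := ν) (a := t n)).symm]
      refine measure_mono fun s hs => ?_
      exact not_lt.1 fun h => hs ⟨n, h⟩
    have hl : Filter.Tendsto (fun n : ℕ => T0 * Θ⁻¹ ^ n) Filter.atTop (nhds (T0 * 0)) :=
      ENNReal.Tendsto.const_mul (ENNReal.tendsto_pow_atTop_nhds_zero_of_lt_one hinv1)
        (Or.inr hT0t)
    rw [mul_zero] at hl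
    exact le_antisymm (ge_of_tendsto' hl hle) zero_le

namespace IsGeometricPartition

variable {ν : Measure ℝ} {Θ : ℝ≥0∞} {t : ℕ → ℝ}

theorem nonneg (h : IsGeometricPartition ν Θ t) (k : ℕ) : 0 ≤ t k := by
  rw [← h.zero]; exact h.strictMono.monotone (Nat.zero_le k)

theorem tail_le_two_mul [IsFiniteMeasure ν] [NullSingletonClass ν]
    (h : IsGeometricPartition ν Θ t) (hΘ : 2 ≤ Θ) (k : ℕ) :
    ν (Ioi (t k)) ≤ 2 * ν (Ico (t k) (t (k + 1))) := by
  have h1 : ν (Ico (t k) (t (k + 1))) + ν (Ioi (t (k + 1))) = ν (Ioi (t k)) := by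
    rw [measure_congr (Ico_ae_eq_Ioc (μ := ν)), ← measure_union (Ioc_disjoint_Ioi le_rfl)
      measurableSet_Ioi, Ioc_union_Ioi_eq_Ioi (h.strictMono (Nat.lt_succ_self k)).le]
  refine ENNReal.le_two_mul_of_le_add_half (measure_ne_top _ _) ?_
  conv_lhs => rw [← h1]
  gcongr
  rw [ENNReal.le_div_iff_mul_le (by simp) (by simp), h.tail k, mul_comm]
  gcongr

theorem setLIntegral_Ici_le (h : IsGeometricPartition ν Θ t) (k : ℕ) (F : ℝ → ℝ≥0∞) :
    ∫⁻ s in Ici (t k), F s ∂ν ≤ ∑' m, ∫⁻ s in Ico (t (k + m)) (t (k + m + 1)), F s ∂ν := by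
  refine le_trans ?_ (lintegral_iUnion_le _ _)
  rw [← lintegral_indicator measurableSet_Ici,
    ← lintegral_indicator (MeasurableSet.iUnion fun _ => measurableSet_Ico)]
  refine lintegral_mono_ae ?_
  filter_upwards [h.exhaust] with s hs
  by_cases hks : t k ≤ s
  · rw [indicator_of_mem (mem_Ici.2 hks), indicator_of_mem]
    classical
    have hn := Nat.find_spec hs
    have hkn : k < Nat.find hs := by
      by_contra hle
      exact absurd (hn.trans_le (h.strictMono.monotone (not_lt.1 hle))) (not_lt.2 hks)
    rw [mem_iUnion]
    refine ⟨Nat.find hs - 1 - k, ?_, ?_⟩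
    · rw [show k + (Nat.find hs - 1 - k) = Nat.find hs - 1 by omega]
      exact not_lt.1 (Nat.find_min hs (by omega))
    · rw [show k + (Nat.find hs - 1 - k) + 1 = Nat.find hs by omega]
      exact hn
  · rw [indicator_of_notMem (by simpa using hks)]
    exact zero_le

end IsGeometricPartition

/-! ### Necessity: discretizing the integrand and the kernel tails -/

section Necessity

variable {q r : ℝ} {θ : ℝ≥0} {U : ℝ → ℝ → ℝ≥0} {v : ℝ → ℝ≥0∞} {ν : Measure ℝ} {Θ : ℝ≥0∞}
  {t : ℕ → ℝ}

/-- S and R are nondecreasing, so the right endpoint is the natural place of comparison, but V is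
nonincreasing and V(t) must be split at s. The resulting factor U(t,s)^{qr} is absorbed by R(t):
since qr + q = r, their product is at most S(s). -/
theorem condDensity_le (hU : IsRegularKernel θ U) (hq0 : 0 < q) (hq1 : q < 1)
    (hr : r = q / (1 - q)) {t s : ℝ} (ht : 0 ≤ t) (hts : t < s) :
    condDensity q r U v ν t ≤ (1 + (1 + (θ : ℝ≥0∞) ^ q) ^ r * 2 ^ r) *
      (ν (Ioi t) ^ r * kernelSup r r U v s + kernelTail q U ν s s ^ r * kernelSup q r U v s) := by
  have h1q : 0 < 1 - q := by linarith
  have hr0 : 0 < r := by rw [hr]; positivity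
  have hqr : q * r + q = r := by rw [hr]; field_simp; ring
  have hV : kernelTail q U ν t t ≤ (1 + (θ : ℝ≥0∞) ^ q) *
      ((U t s : ℝ≥0∞) ^ q * ν (Ioi t) + kernelTail q U ν s s) := by
    have h1 : kernelTail q U ν t t = ∫⁻ u in Ioc t s, (U t u : ℝ≥0∞) ^ q ∂ν +
        kernelTail q U ν t s := by
      unfold kernelTail
      rw [← lintegral_union measurableSet_Ioi (Ioc_disjoint_Ioi le_rfl), Ioc_union_Ioi_eq_Ioi hts.le]
    have h2 : ∫⁻ u in Ioc t s, (U t u : ℝ≥0∞) ^ q ∂ν ≤ (U t s : ℝ≥0∞) ^ q * ν (Ioi t) := by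
      calc ∫⁻ u in Ioc t s, (U t u : ℝ≥0∞) ^ q ∂ν ≤ ∫⁻ u in Ioc t s, (U t s : ℝ≥0∞) ^ q ∂ν :=
            setLIntegral_mono' measurableSet_Ioc fun u hu =>
              hU.rpow_le_right hq0.le ht (ht.trans hu.1.le) hu.2
        _ = (U t s : ℝ≥0∞) ^ q * ν (Ioc t s) := setLIntegral_const _ _
        _ ≤ _ := by gcongr; exact Ioc_subset_Ioi_self
    rw [h1, add_mul, one_mul]
    refine add_le_add (h2.trans le_self_add) ((hU.kernelTail_le hq0.le hq1.le ν ht hts).trans ?_)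
    gcongr
  have hVr : kernelTail q U ν t t ^ r ≤ (1 + (θ : ℝ≥0∞) ^ q) ^ r * 2 ^ r *
      ((U t s : ℝ≥0∞) ^ (q * r) * ν (Ioi t) ^ r + kernelTail q U ν s s ^ r) := by
    refine (ENNReal.rpow_le_rpow hV hr0.le).trans ?_
    rw [ENNReal.mul_rpow_of_nonneg _ _ hr0.le, mul_assoc]
    gcongr
    refine (ENNReal.add_rpow_le_two_rpow_mul hr0.le _ _).trans ?_
    rw [ENNReal.mul_rpow_of_nonneg _ _ hr0.le, ← ENNReal.rpow_mul]
  have hUR : (U t s : ℝ≥0∞) ^ (q * r) * kernelSup q r U v t ≤ kernelSup r r U v s := by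
    unfold kernelSup
    rw [← ENNReal.essSup_const_mul]
    refine le_trans (essSup_mono_ae ?_)
      (essSup_mono_measure' (Measure.restrict_mono (Ioo_subset_Ioo_right hts.le) le_rfl))
    filter_upwards [ae_restrict_mem measurableSet_Ioo] with z hz
    rw [← mul_assoc]
    gcongr
    calc (U t s : ℝ≥0∞) ^ (q * r) * (U z t : ℝ≥0∞) ^ q
        ≤ (U z s : ℝ≥0∞) ^ (q * r) * (U z s : ℝ≥0∞) ^ q := by
          gcongr
          · exact hU.le_left hz.1.le hz.2.le (ht.trans hts.le)
          · exact hU.le_right hz.1.le ht hts.le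
      _ = _ := by rw [← ENNReal.rpow_add_of_nonneg _ _ (by positivity) hq0.le, hqr]
  have hS := hU.kernelSup_mono hr0.le r v hts.le
  have hR := hU.kernelSup_mono hq0.le r v hts.le
  set C := (1 + (θ : ℝ≥0∞) ^ q) ^ r * 2 ^ r
  unfold condDensity
  calc _ ≤ ν (Ioi t) ^ r * kernelSup r r U v s + C *
      ((U t s : ℝ≥0∞) ^ (q * r) * ν (Ioi t) ^ r + kernelTail q U ν s s ^ r) *
        kernelSup q r U v t := by gcongr
    _ = ν (Ioi t) ^ r * kernelSup r r U v s + C *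
      (ν (Ioi t) ^ r * ((U t s : ℝ≥0∞) ^ (q * r) * kernelSup q r U v t) +
        kernelTail q U ν s s ^ r * kernelSup q r U v t) := by ring
    _ ≤ ν (Ioi t) ^ r * kernelSup r r U v s + C *
      (ν (Ioi t) ^ r * kernelSup r r U v s +
        kernelTail q U ν s s ^ r * kernelSup q r U v s) := by gcongr
    _ ≤ (ν (Ioi t) ^ r * kernelSup r r U v s +
          kernelTail q U ν s s ^ r * kernelSup q r U v s) + C *
      (ν (Ioi t) ^ r * kernelSup r r U v s +
        kernelTail q U ν s s ^ r * kernelSup q r U v s) := by gcongr; exact le_self_add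
    _ = _ := by ring

/-- The choice of Θ makes the decay of the tails beat the factor θ^q of the triangle inequality by
2. -/
theorem IsGeometricPartition.rpow_mul_tail_le (h : IsGeometricPartition ν Θ t)
    (hΘ : Θ = 2 * (1 + (θ : ℝ≥0∞) ^ q)) (k : ℕ) :
    (θ : ℝ≥0∞) ^ q * ν (Ioi (t (k + 1))) ≤ 2⁻¹ * ν (Ioi (t k)) := by
  rw [h.tail k, hΘ, ← mul_assoc, ← mul_assoc, ENNReal.inv_mul_cancel (by simp) (by simp), one_mul]
  gcongr
  exact le_add_self

/-- The weights of the discretized second condition. -/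
noncomputable def stepWeight (q : ℝ) (U : ℝ → ℝ → ℝ≥0) (ν : Measure ℝ) (t : ℕ → ℝ) (i : ℕ) :
    ℝ≥0∞ :=
  ν (Ioi (t i)) * (U (t i) (t (i + 1)) : ℝ≥0∞) ^ q

/-- The integral over each block is at most Θ ν(t_{k+m+1},∞) U(t_k,t_{k+m+1})^q. By the triangle
inequality these quantities contract by 1/2 from block to block, up to a source `stepWeight`. -/
theorem kernelTail_le_tailSum [IsFiniteMeasure ν] [NullSingletonClass ν]
    (hU : IsRegularKernel θ U) (hq0 : 0 < q) (hq1 : q < 1)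
    (h : IsGeometricPartition ν Θ t) (hΘ : Θ = 2 * (1 + (θ : ℝ≥0∞) ^ q)) (k : ℕ) :
    kernelTail q U ν (t k) (t k) ≤ 2 * Θ * tailSum (stepWeight q U ν t) k := by
  have hmono := h.strictMono.monotone
  -- The entry at 0 is not needed and is set to 0, so the contraction leaves no initial term.
  set Y : ℕ → ℝ≥0∞ := fun m => Nat.casesOn m 0 fun m =>
    ν (Ioi (t (k + m + 1))) * (U (t k) (t (k + m + 1)) : ℝ≥0∞) ^ q with hY
  have hstep : ∀ m, Y (m + 1) ≤ 2⁻¹ * Y m + stepWeight q U ν t (k + m) := by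
    intro m
    cases m with
    | zero =>
      exact le_trans (mul_le_mul_left (measure_mono (Ioi_subset_Ioi (hmono (Nat.le_succ k)))) _)
        le_add_self
    | succ m =>
      simp only [hY, stepWeight]
      have htri := hU.rpow_triangle hq0.le hq1.le (h.nonneg k)
        (h.strictMono (show k < k + m + 1 by omega)) (h.strictMono (Nat.lt_succ_self (k + m + 1)))
      calc ν (Ioi (t (k + m + 1 + 1))) * (U (t k) (t (k + m + 1 + 1)) : ℝ≥0∞) ^ q
          ≤ ν (Ioi (t (k + m + 1 + 1))) * ((θ : ℝ≥0∞) ^ q * ((U (t k) (t (k + m + 1)) : ℝ≥0∞) ^ q +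
            (U (t (k + m + 1)) (t (k + m + 1 + 1)) : ℝ≥0∞) ^ q)) := by gcongr
        _ = (θ : ℝ≥0∞) ^ q * ν (Ioi (t (k + m + 1 + 1))) * ((U (t k) (t (k + m + 1)) : ℝ≥0∞) ^ q +
            (U (t (k + m + 1)) (t (k + m + 1 + 1)) : ℝ≥0∞) ^ q) := by ring
        _ ≤ 2⁻¹ * ν (Ioi (t (k + m + 1))) * ((U (t k) (t (k + m + 1)) : ℝ≥0∞) ^ q +
            (U (t (k + m + 1)) (t (k + m + 1 + 1)) : ℝ≥0∞) ^ q) :=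
            mul_le_mul_left (h.rpow_mul_tail_le hΘ _) _
        _ = 2⁻¹ * (ν (Ioi (t (k + m + 1))) * (U (t k) (t (k + m + 1)) : ℝ≥0∞) ^ q) +
            2⁻¹ * (ν (Ioi (t (k + m + 1))) *
              (U (t (k + m + 1)) (t (k + m + 1 + 1)) : ℝ≥0∞) ^ q) := by ring
        _ ≤ _ := add_le_add le_rfl (mul_le_of_le_one_left' (ENNReal.inv_le_one.2 one_le_two))
  have hsum := tsum_le_of_contracting hstep rfl
  have htail : ∑' m, stepWeight q U ν t (k + m) ≤ tailSum (stepWeight q U ν t) k := by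
    have := ENNReal.tsum_comp_le_tsum_of_injective (f := fun m => k + m)
      (add_right_injective k) (fun i => if k ≤ i then stepWeight q U ν t i else 0)
    simpa [tailSum] using this
  calc kernelTail q U ν (t k) (t k) ≤ ∫⁻ s in Ici (t k), (U (t k) s : ℝ≥0∞) ^ q ∂ν :=
        lintegral_mono_set Ioi_subset_Ici_self
    _ ≤ ∑' m, ∫⁻ s in Ico (t (k + m)) (t (k + m + 1)), (U (t k) s : ℝ≥0∞) ^ q ∂ν :=
        h.setLIntegral_Ici_le k _
    _ ≤ ∑' m, Θ * Y (m + 1) := by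
        refine ENNReal.tsum_le_tsum fun m => ?_
        calc ∫⁻ s in Ico (t (k + m)) (t (k + m + 1)), (U (t k) s : ℝ≥0∞) ^ q ∂ν
            ≤ ∫⁻ s in Ico (t (k + m)) (t (k + m + 1)), (U (t k) (t (k + m + 1)) : ℝ≥0∞) ^ q ∂ν :=
              setLIntegral_mono' measurableSet_Ico fun s hs =>
                hU.rpow_le_right hq0.le (h.nonneg k) ((h.nonneg _).trans hs.1) hs.2.le
          _ = (U (t k) (t (k + m + 1)) : ℝ≥0∞) ^ q * ν (Ico (t (k + m)) (t (k + m + 1))) :=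
              setLIntegral_const _ _
          _ ≤ (U (t k) (t (k + m + 1)) : ℝ≥0∞) ^ q * ν (Ioi (t (k + m))) := by
              gcongr 1
              rw [measure_congr (Ico_ae_eq_Ioc (μ := ν))]
              exact measure_mono Ioc_subset_Ioi_self
          _ = Θ * Y (m + 1) := by
              rw [h.tail (k + m)]; simp only [hY]; ring
    _ = Θ * ∑' m, Y (m + 1) := ENNReal.tsum_mul_left
    _ ≤ Θ * ∑' m, Y m :=
        mul_le_mul_right (ENNReal.tsum_comp_le_tsum_of_injective (add_left_injective 1) Y) Θ
    _ ≤ Θ * (2 * tailSum (stepWeight q U ν t) k) := by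
        gcongr
        exact hsum.trans (by gcongr)
    _ = _ := by ring

/-- In the tail from j, the entry at j is bounded through the second argument of the minimum and the
later ones through the first. Each part gives half of `tailSum g j`. -/
theorem tailSum_shift_le {g e : ℕ → ℝ≥0∞} (h0 : e 0 = 0)
    (he : ∀ i, e (i + 1) ≤ 2⁻¹ * min (g i) (tailSum g (i + 1))) (j : ℕ) :
    tailSum e j ≤ tailSum g j := by
  have hpt : ∀ i, (if j ≤ i then e i else 0) ≤ (if i = j then 2⁻¹ * tailSum g j else 0) +
      (Nat.casesOn i 0 fun i => if j ≤ i then 2⁻¹ * g i else 0 : ℝ≥0∞) := by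
    intro i
    cases i with
    | zero => simp [h0]
    | succ i =>
      by_cases hj : j ≤ i
      · rw [if_pos (by omega)]
        simp only [hj, if_true]
        refine le_trans ((he i).trans ?_) le_add_self
        gcongr; exact min_le_left _ _
      · by_cases hji : j = i + 1
        · subst hji
          simp only [le_refl, if_true]
          refine le_trans ((he i).trans ?_) le_self_add
          gcongr; exact min_le_right _ _
        · rw [if_neg (by omega)]; exact zero_le
  refine (ENNReal.tsum_le_tsum hpt).trans ?_
  have hg : ∑' i, (if j ≤ i then 2⁻¹ * g i else 0) = 2⁻¹ * tailSum g j := by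
    rw [tailSum, ← ENNReal.tsum_mul_left]
    exact tsum_congr fun i => by split_ifs <;> simp
  rw [ENNReal.tsum_add, tsum_ite_eq, tsum_eq_zero_add' ENNReal.summable]
  change _ + (0 + ∑' i, (if j ≤ i then 2⁻¹ * g i else 0)) ≤ _
  rw [zero_add, hg, ← add_mul, ENNReal.inv_two_add_inv_two, one_mul]

end Necessity

/-! ### Necessity: the recursion for A₄* and the conclusion -/

section Necessity

variable {q r : ℝ} {θ : ℝ≥0} {U : ℝ → ℝ → ℝ≥0} {v : ℝ → ℝ≥0∞} {ν : Measure ℝ} {Θ : ℝ≥0∞}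
  {t : ℕ → ℝ}

/-- The general term of the discretized second condition. -/
noncomputable def stepTerm (q r : ℝ) (U : ℝ → ℝ → ℝ≥0) (v : ℝ → ℝ≥0∞) (ν : Measure ℝ)
    (t : ℕ → ℝ) (k : ℕ) : ℝ≥0∞ :=
  ν (Ioi (t k)) * kernelTail q U ν (t k) (t k) ^ r * kernelSup q r U v (t k)

theorem stepTerm_succ_le [IsFiniteMeasure ν] [NullSingletonClass ν]
    (hU : IsRegularKernel θ U) (hq0 : 0 < q) (hq1 : q < 1) (hr : r = q / (1 - q))
    (h : IsGeometricPartition ν Θ t) (hΘ : Θ = 2 * (1 + (θ : ℝ≥0∞) ^ q)) (k : ℕ) :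
    stepTerm q r U v ν t (k + 1) ≤ 2⁻¹ * stepTerm q r U v ν t k + (2 * Θ) ^ r *
      (stepWeight q U ν t k * tailSum (stepWeight q U ν t) k ^ r * kernelSup 0 r U v (t k) +
        ν (Ioi (t (k + 1))) ^ (1 + r) * kernelSup r r U v (t (k + 1)) +
        min (stepWeight q U ν t k) (tailSum (stepWeight q U ν t) (k + 1)) *
          tailSum (stepWeight q U ν t) (k + 1) ^ r * kernelSup 0 r U v (t (k + 1))) := by
  have h1q : 0 < 1 - q := by linarith
  have hr0 : 0 < r := by rw [hr]; positivity
  have hqr : q * (1 + r) = r := by rw [hr]; field_simp; ring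
  set g := stepWeight q U ν t with hg
  set s := t k with hs
  set s' := t (k + 1) with hs'
  have hs0 : 0 ≤ s := h.nonneg k
  have hss : s < s' := h.strictMono (Nat.lt_succ_self k)
  set X := tailSum g k
  set X' := tailSum g (k + 1)
  set V' := kernelTail q U ν s' s'
  have hV : kernelTail q U ν s s ≤ 2 * Θ * X := kernelTail_le_tailSum hU hq0 hq1 h hΘ k
  have hV' : V' ≤ 2 * Θ * X' := kernelTail_le_tailSum hU hq0 hq1 h hΘ (k + 1)
  have hVV : V' ≤ kernelTail q U ν s s :=
    hU.kernelTail_le_kernelTail hq0.le ν hs0 hss.le le_rfl hss.le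
  have hT : ν (Ioi s') ≤ ν (Ioi s) := measure_mono (Ioi_subset_Ioi hss.le)
  have hR := ENNReal.ae_le_essSup (μ := volume.restrict (Ioo 0 s))
    (fun z => (U z s : ℝ≥0∞) ^ q * v z ^ (-r))
  have hσ := ENNReal.ae_le_essSup (μ := volume.restrict (Ioo 0 s))
    (fun z => (U z s : ℝ≥0∞) ^ (0 : ℝ) * v z ^ (-r))
  have hσ' := ENNReal.ae_le_essSup (μ := volume.restrict (Ioo 0 s'))
    (fun z => (U z s' : ℝ≥0∞) ^ (0 : ℝ) * v z ^ (-r))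
  have hS' := ENNReal.ae_le_essSup (μ := volume.restrict (Ioo 0 s'))
    (fun z => (U z s' : ℝ≥0∞) ^ r * v z ^ (-r))
  change ∀ᵐ z ∂_, _ ≤ kernelSup q r U v s at hR
  change ∀ᵐ z ∂_, _ ≤ kernelSup 0 r U v s at hσ
  change ∀ᵐ z ∂_, _ ≤ kernelSup 0 r U v s' at hσ'
  change ∀ᵐ z ∂_, _ ≤ kernelSup r r U v s' at hS'
  simp only [ENNReal.rpow_zero, one_mul] at hσ hσ'
  rw [ae_restrict_iff' measurableSet_Ioo] at hR hσ hσ' hS'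
  rw [stepTerm]
  change ν (Ioi s') * V' ^ r * essSup _ _ ≤ _
  rw [← ENNReal.essSup_const_mul]
  refine essSup_le_of_ae_le _ ?_
  rw [Filter.EventuallyLE, ae_restrict_iff' measurableSet_Ioo]
  filter_upwards [hR, hσ, hσ', hS'] with z hRz hσz hσ'z hS'z hz
  rcases lt_or_ge z s with hzs | hzs
  -- For z < t_k the triangle inequality at t_k reproduces the previous term with factor 1/2, plus a
  -- term with U(t_k,t_{k+1})^q in which z enters only through v.
  · specialize hRz ⟨hz.1, hzs⟩
    specialize hσz ⟨hz.1, hzs⟩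
    set u := (U s s' : ℝ≥0∞) ^ q
    calc ν (Ioi s') * V' ^ r * ((U z s' : ℝ≥0∞) ^ q * v z ^ (-r))
        ≤ ν (Ioi s') * V' ^ r * (((θ : ℝ≥0∞) ^ q * ((U z s : ℝ≥0∞) ^ q + u)) * v z ^ (-r)) := by
          gcongr
          exact hU.rpow_triangle hq0.le hq1.le hz.1.le hzs hss
      _ = (θ : ℝ≥0∞) ^ q * ν (Ioi s') * (V' ^ r * ((U z s : ℝ≥0∞) ^ q * v z ^ (-r)) +
            V' ^ r * (u * v z ^ (-r))) := by ring
      _ ≤ 2⁻¹ * ν (Ioi s) * (kernelTail q U ν s s ^ r * kernelSup q r U v s +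
            (2 * Θ * X) ^ r * (u * kernelSup 0 r U v s)) := by
          refine mul_le_mul' (h.rpow_mul_tail_le hΘ k) (add_le_add ?_ ?_)
          · gcongr
          · gcongr
            exact hVV.trans hV
      _ = 2⁻¹ * (ν (Ioi s) * kernelTail q U ν s s ^ r * kernelSup q r U v s) +
            2⁻¹ * ((2 * Θ) ^ r * (ν (Ioi s) * u * X ^ r * kernelSup 0 r U v s)) := by
          rw [ENNReal.mul_rpow_of_nonneg _ _ hr0.le]; ring
      _ ≤ _ := by
          refine add_le_add le_rfl
            ((mul_le_of_le_one_left' (ENNReal.inv_le_one.2 one_le_two)).trans ?_)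
          refine mul_le_mul_right ?_ _
          rw [add_assoc]
          exact le_self_add
  · specialize hσ'z hz
    specialize hS'z hz
    set α := ν (Ioi s') * (U z s' : ℝ≥0∞) ^ q with hα
    have hαg : α ≤ g k := by
      refine mul_le_mul' hT (hU.rpow_le_left hq0.le hs0 hzs (hs0.trans hss.le))
    -- If X' ≤ α, the power α^{1+r} is available, and q(1+r) = r turns it into a term of the
    -- discrete A₃* sum. If α ≤ X', then α is below the minimum, a sequence admissible after a
    -- shift.
    have hmin : α * X' ^ r ≤ α ^ (1 + r) + min (g k) X' * X' ^ r := by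
      rcases le_total X' α with hle | hle
      · refine le_trans ?_ le_self_add
        rw [ENNReal.rpow_add_of_nonneg _ _ zero_le_one hr0.le, ENNReal.rpow_one]
        gcongr
      · refine le_trans ?_ le_add_self
        gcongr
        exact le_min hαg hle
    have hαr : α ^ (1 + r) * v z ^ (-r) ≤ ν (Ioi s') ^ (1 + r) * kernelSup r r U v s' := by
      rw [hα, ENNReal.mul_rpow_of_nonneg _ _ (by positivity), ← ENNReal.rpow_mul, hqr, mul_assoc]
      gcongr
    calc ν (Ioi s') * V' ^ r * ((U z s' : ℝ≥0∞) ^ q * v z ^ (-r))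
        = α * V' ^ r * v z ^ (-r) := by rw [hα]; ring
      _ ≤ α * (2 * Θ * X') ^ r * v z ^ (-r) := by gcongr
      _ = (2 * Θ) ^ r * (α * X' ^ r * v z ^ (-r)) := by
          rw [ENNReal.mul_rpow_of_nonneg _ _ hr0.le]; ring
      _ ≤ (2 * Θ) ^ r * ((α ^ (1 + r) + min (g k) X' * X' ^ r) * v z ^ (-r)) := by gcongr
      _ = (2 * Θ) ^ r * (α ^ (1 + r) * v z ^ (-r) + min (g k) X' * X' ^ r * v z ^ (-r)) := by ring
      _ ≤ (2 * Θ) ^ r * (ν (Ioi s') ^ (1 + r) * kernelSup r r U v s' +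
            min (g k) X' * X' ^ r * kernelSup 0 r U v s') := by gcongr
      _ ≤ _ := by
          refine le_trans ?_ le_add_self
          refine mul_le_mul_right ?_ _
          rw [add_assoc]
          exact le_add_self

/-- The constant of the necessity part. -/
noncomputable def necConst (q r : ℝ) (θ : ℝ≥0) : ℝ≥0∞ :=
  let Θ : ℝ≥0∞ := 2 * (1 + (θ : ℝ≥0∞) ^ q)
  let a : ℝ≥0∞ := 2 ^ (1 + r) * (2 * (2 ^ (2 + r)) ^ (1 + r))
  let b : ℝ≥0∞ := 2 * (2 ^ (2 + r) * (2 * Θ)) ^ (1 + r)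
  (1 + (1 + (θ : ℝ≥0∞) ^ q) ^ r * 2 ^ r) *
    (Θ ^ (1 + r) * a + Θ * (2 * ((2 * Θ) ^ r * (b + a + 2 * b))))

theorem necConst_ne_top (hq0 : 0 < q) (hr0 : 0 < r) : necConst q r θ ≠ ∞ := by
  have hθ : (θ : ℝ≥0∞) ^ q ≠ ∞ := ENNReal.rpow_ne_top_of_nonneg hq0.le ENNReal.coe_ne_top
  have h1 : (1 + (θ : ℝ≥0∞) ^ q) ≠ ∞ := ENNReal.add_ne_top.2 ⟨by simp, hθ⟩
  have h2 : (2 : ℝ≥0∞) ≠ ∞ := by simp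
  have hr1 : 0 ≤ 1 + r := by positivity
  have hr2 : 0 ≤ 2 + r := by positivity
  have hΘ : 2 * (1 + (θ : ℝ≥0∞) ^ q) ≠ ∞ := ENNReal.mul_ne_top h2 h1
  have h2Θ := ENNReal.mul_ne_top h2 hΘ
  have h22 := ENNReal.rpow_ne_top_of_nonneg hr2 h2
  have ha := ENNReal.mul_ne_top (ENNReal.rpow_ne_top_of_nonneg hr1 h2)
    (ENNReal.mul_ne_top h2 (ENNReal.rpow_ne_top_of_nonneg hr1 h22))
  have hb := ENNReal.mul_ne_top h2 (ENNReal.rpow_ne_top_of_nonneg hr1 (ENNReal.mul_ne_top h22 h2Θ))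
  unfold necConst
  refine ENNReal.mul_ne_top (ENNReal.add_ne_top.2 ⟨by simp, ENNReal.mul_ne_top
    (ENNReal.rpow_ne_top_of_nonneg hr0.le h1) (ENNReal.rpow_ne_top_of_nonneg hr0.le h2)⟩) ?_
  refine ENNReal.add_ne_top.2 ⟨ENNReal.mul_ne_top (ENNReal.rpow_ne_top_of_nonneg hr1 hΘ) ha,
    ENNReal.mul_ne_top hΘ (ENNReal.mul_ne_top h2 (ENNReal.mul_ne_top
      (ENNReal.rpow_ne_top_of_nonneg hr0.le h2Θ) ?_))⟩
  exact ENNReal.add_ne_top.2 ⟨ENNReal.add_ne_top.2 ⟨hb, ha⟩, ENNReal.mul_ne_top h2 hb⟩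

theorem lintegral_condDensity_le_of_partition [IsFiniteMeasure ν] [NullSingletonClass ν]
    (hU : IsRegularKernel θ U) (hq0 : 0 < q) (hq1 : q < 1) (hr : r = q / (1 - q))
    (hv : IsWeight v) (hν : ν ≪ volume.restrict (Ioi (0 : ℝ)))
    (h : IsGeometricPartition ν Θ t) (hΘ : Θ = 2 * (1 + (θ : ℝ≥0∞) ^ q))
    {D : ℝ≥0∞} (hD : D ≠ ∞) (H : HardyBound q U v ν D) :
    ∫⁻ s, condDensity q r U v ν s ∂ν ≤ necConst q r θ * D ^ (1 + r) := by
  have h1q : 0 < 1 - q := by linarith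
  have hr0 : 0 < r := by rw [hr]; positivity
  have hr1 : 0 ≤ 1 + r := by positivity
  have hΘ2 : 2 ≤ Θ := by
    rw [hΘ]
    calc (2 : ℝ≥0∞) = 2 * 1 := (mul_one _).symm
      _ ≤ _ := by gcongr; exact le_self_add
  have hΘt : Θ ≠ ∞ := by
    rw [hΘ]
    exact ENNReal.mul_ne_top (by simp) (ENNReal.add_ne_top.2
      ⟨by simp, ENNReal.rpow_ne_top_of_nonneg hq0.le ENNReal.coe_ne_top⟩)
  have hmono := h.strictMono.monotone
  set g := stepWeight q U ν t with hg
  set X := tailSum g with hX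
  set a : ℝ≥0∞ := 2 ^ (1 + r) * (2 * (2 ^ (2 + r)) ^ (1 + r)) with ha
  set b : ℝ≥0∞ := 2 * (2 ^ (2 + r) * (2 * Θ)) ^ (1 + r) with hb
  have hA : ∑' k, ν (Ioi (t k)) ^ (1 + r) * kernelSup r r U v (t k) ≤ a * D ^ (1 + r) := by
    have h1 := tsum_mul_kernelSup_le hU hq0 hq1 hr hv hν hD H hmono h.nonneg
    rw [ENNReal.mul_rpow_of_nonneg _ _ hr1] at h1
    rw [ha, mul_assoc, mul_assoc]
    refine le_trans ?_ (mul_le_mul_right h1 _)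
    rw [← ENNReal.tsum_mul_left]
    refine ENNReal.tsum_le_tsum fun k => ?_
    rw [← mul_assoc]
    gcongr
    set I := ν (Ico (t k) (t (k + 1))) with hI
    calc ν (Ioi (t k)) ^ (1 + r) ≤ (2 * I) ^ (1 + r) := by
          gcongr; exact h.tail_le_two_mul hΘ2 k
      _ = 2 ^ (1 + r) * (I * I ^ r) := by
          rw [ENNReal.mul_rpow_of_nonneg _ _ hr1, ENNReal.rpow_add_of_nonneg (x := I) 1 r zero_le_one hr0.le,
            ENNReal.rpow_one]
      _ ≤ _ := by
          gcongr
          exact le_tailSum (fun i => ν (Ico (t i) (t (i + 1)))) k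
  have hgM : ∀ i, g i ≤ 2 * Θ *
      (ν (Ico (t (i + 1)) (t (i + 2))) * (U (t i) (t (i + 1)) : ℝ≥0∞) ^ q) := by
    intro i
    calc g i = Θ * ν (Ioi (t (i + 1))) * (U (t i) (t (i + 1)) : ℝ≥0∞) ^ q := by
          rw [← h.tail i]; rfl
      _ ≤ Θ * (2 * ν (Ico (t (i + 1)) (t (i + 2)))) * (U (t i) (t (i + 1)) : ℝ≥0∞) ^ q := by
          gcongr; exact h.tail_le_two_mul hΘ2 (i + 1)
      _ = _ := by ring
  have hBe : ∀ e : ℕ → ℝ≥0∞, (∀ j, tailSum e j ≤ X j) →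
      ∑' i, e i * X i ^ r * kernelSup 0 r U v (t i) ≤ b * D ^ (1 + r) := by
    intro e he
    have h1 := tsum_mul_kernelSup_zero_le hU hq0 hq1 hr hv hν hD H hmono h.nonneg
      (ENNReal.mul_ne_top (by simp) hΘt) hgM he
    rw [← mul_assoc, ENNReal.mul_rpow_of_nonneg _ D hr1, ← mul_assoc] at h1
    exact h1
  have hB1 : ∑' k, g k * X k ^ r * kernelSup 0 r U v (t k) ≤ b * D ^ (1 + r) :=
    hBe g fun _ => le_rfl
  have hB2 : ∑' k, min (g k) (X (k + 1)) * X (k + 1) ^ r * kernelSup 0 r U v (t (k + 1)) ≤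
      2 * (b * D ^ (1 + r)) := by
    -- Half of the minimum, moved one index up, has tails dominated by those of g; the factor 2 in
    -- `hB2` undoes the halving.
    set e : ℕ → ℝ≥0∞ := fun i => Nat.casesOn i 0 fun i => 2⁻¹ * min (g i) (X (i + 1)) with he
    have h1 := hBe e (tailSum_shift_le rfl fun i => le_rfl)
    refine le_trans ?_ (mul_le_mul_right ((ENNReal.tsum_comp_le_tsum_of_injective
      (add_left_injective 1) _).trans h1) 2)
    rw [← ENNReal.tsum_mul_left]
    refine ENNReal.tsum_le_tsum fun k => le_of_eq ?_
    change _ = 2 * (2⁻¹ * min (g k) (X (k + 1)) * X (k + 1) ^ r * kernelSup 0 r U v (t (k + 1)))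
    rw [← mul_assoc, ← mul_assoc, ← mul_assoc, ENNReal.mul_inv_cancel (by simp) (by simp), one_mul]
  -- Since t_0 = 0, the supremum is over an empty interval.
  have hY0 : stepTerm q r U v ν t 0 = 0 := by
    simp [stepTerm, kernelSup, h.zero]
  have hY : ∑' k, stepTerm q r U v ν t k ≤
      2 * ((2 * Θ) ^ r * (b + a + 2 * b)) * D ^ (1 + r) := by
    refine (tsum_le_of_contracting (stepTerm_succ_le hU hq0 hq1 hr h hΘ) hY0).trans ?_
    rw [ENNReal.tsum_mul_left, ENNReal.tsum_add, ENNReal.tsum_add, mul_assoc, mul_assoc]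
    refine mul_le_mul_right (mul_le_mul_right ?_ _) _
    calc _ ≤ b * D ^ (1 + r) + a * D ^ (1 + r) + 2 * (b * D ^ (1 + r)) := by
          refine add_le_add (add_le_add hB1 ?_) hB2
          exact (ENNReal.tsum_comp_le_tsum_of_injective (add_left_injective 1)
            fun k => ν (Ioi (t k)) ^ (1 + r) * kernelSup r r U v (t k)).trans hA
      _ = _ := by ring
  set c : ℝ≥0∞ := 1 + (1 + (θ : ℝ≥0∞) ^ q) ^ r * 2 ^ r with hc
  have hpos : ∀ᵐ s ∂ν, 0 < s := hν.ae_le (ae_restrict_mem measurableSet_Ioi)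
  calc ∫⁻ s, condDensity q r U v ν s ∂ν = ∫⁻ s in Ici (t 0), condDensity q r U v ν s ∂ν := by
        rw [h.zero, Measure.restrict_eq_self_of_ae_mem]
        filter_upwards [hpos] with s hs using le_of_lt hs
    _ ≤ ∑' k, ∫⁻ s in Ico (t (0 + k)) (t (0 + k + 1)), condDensity q r U v ν s ∂ν :=
        h.setLIntegral_Ici_le 0 _
    _ ≤ ∑' k, c * (Θ ^ (1 + r) * (ν (Ioi (t (k + 1))) ^ (1 + r) * kernelSup r r U v (t (k + 1))) +
          Θ * stepTerm q r U v ν t (k + 1)) := by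
        refine ENNReal.tsum_le_tsum fun k => ?_
        rw [zero_add]
        set N := ν (Ioi (t k)) ^ r * kernelSup r r U v (t (k + 1)) +
          kernelTail q U ν (t (k + 1)) (t (k + 1)) ^ r * kernelSup q r U v (t (k + 1)) with hN
        calc ∫⁻ s in Ico (t k) (t (k + 1)), condDensity q r U v ν s ∂ν
            ≤ ∫⁻ s in Ico (t k) (t (k + 1)), c * N ∂ν := by
              refine setLIntegral_mono' measurableSet_Ico fun s hs => ?_
              refine (condDensity_le hU hq0 hq1 hr ((h.nonneg k).trans hs.1) hs.2).trans ?_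
              rw [hN, ← hc]
              gcongr
              exact hs.1
          _ = c * N * ν (Ico (t k) (t (k + 1))) := setLIntegral_const _ _
          _ ≤ c * N * ν (Ioi (t k)) := by
              gcongr 1
              rw [measure_congr (Ico_ae_eq_Ioc (μ := ν))]
              exact measure_mono Ioc_subset_Ioi_self
          _ = _ := by
              rw [hN, h.tail k, stepTerm, ENNReal.mul_rpow_of_nonneg _ _ hr0.le,
                ENNReal.rpow_add_of_nonneg _ _ zero_le_one hr0.le,
                ENNReal.rpow_add_of_nonneg _ _ zero_le_one hr0.le, ENNReal.rpow_one,
                ENNReal.rpow_one]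
              ring
    _ = c * (Θ ^ (1 + r) * (∑' k, ν (Ioi (t (k + 1))) ^ (1 + r) * kernelSup r r U v (t (k + 1))) +
          Θ * ∑' k, stepTerm q r U v ν t (k + 1)) := by
        rw [ENNReal.tsum_mul_left, ENNReal.tsum_add, ENNReal.tsum_mul_left, ENNReal.tsum_mul_left]
    _ ≤ c * (Θ ^ (1 + r) * (a * D ^ (1 + r)) +
          Θ * (2 * ((2 * Θ) ^ r * (b + a + 2 * b)) * D ^ (1 + r))) := by
        refine mul_le_mul_right (add_le_add (mul_le_mul_right ?_ _) (mul_le_mul_right ?_ _)) _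
        · exact (ENNReal.tsum_comp_le_tsum_of_injective (add_left_injective 1)
            fun k => ν (Ioi (t k)) ^ (1 + r) * kernelSup r r U v (t k)).trans hA
        · exact (ENNReal.tsum_comp_le_tsum_of_injective (add_left_injective 1) _).trans hY
    _ = _ := by
        simp only [necConst, ← hΘ, ← ha, ← hb, ← hc]
        ring

theorem lintegral_condDensity_le [NullSingletonClass ν]
    (hU : IsRegularKernel θ U) (hq0 : 0 < q) (hq1 : q < 1) (hr : r = q / (1 - q))
    (hv : IsWeight v) (hν : ν ≪ volume.restrict (Ioi (0 : ℝ)))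
    (hfin : ∀ n : ℝ, ν (Iio n) < ∞) {D : ℝ≥0∞} (hD : D ≠ ∞) (H : HardyBound q U v ν D) :
    ∫⁻ s, condDensity q r U v ν s ∂ν ≤ necConst q r θ * D ^ (1 + r) := by
  have h1q : 0 < 1 - q := by linarith
  have hr0 : 0 < r := by rw [hr]; positivity
  have hpos : ∀ᵐ s ∂ν, 0 < s := hν.ae_le (ae_restrict_mem measurableSet_Ioi)
  have htop : ∀ s, ν univ ≤ ν (Iio (s + 1)) + ν (Ioi s) := fun s => by
    refine le_trans (measure_mono fun x _ => ?_) (measure_union_le _ _)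
    rcases lt_or_ge x (s + 1) with h | h
    · exact Or.inl h
    · exact Or.inr (lt_of_lt_of_le (by linarith) h)
  -- Mass is finite on every (-∞,n), so infinite total mass makes all tails infinite and both
  -- suprema vanish.
  by_cases huniv : ν univ = ∞
  · refine le_trans (le_of_eq ?_) zero_le
    rw [← lintegral_zero (μ := ν)]
    refine lintegral_congr_ae ?_
    filter_upwards [hpos] with s hs
    have hT : ν (Ioi s) = ∞ := by
      by_contra hne
      exact (ENNReal.add_ne_top.2 ⟨(hfin (s + 1)).ne, hne⟩) (top_le_iff.1 (huniv ▸ htop s))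
    obtain ⟨h1, h2⟩ := kernelSup_eq_zero_of_measure_eq_top hU hq0 hr0 hv hD H hs hT
    simp [condDensity, h1, h2]
  have : IsFiniteMeasure ν := ⟨lt_top_iff_ne_top.2 huniv⟩
  by_cases h0 : ν (Ioi 0) = 0
  · have hν0 : ν = 0 := by
      rw [← Measure.restrict_eq_self_of_ae_mem (s := Ioi (0 : ℝ)) hpos, Measure.restrict_eq_zero]
      exact h0
    simp [hν0]
  have hΘ2 : (2 : ℝ≥0∞) ≤ 2 * (1 + (θ : ℝ≥0∞) ^ q) := by
    calc (2 : ℝ≥0∞) = 2 * 1 := (mul_one _).symm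
      _ ≤ _ := by gcongr; exact le_self_add
  have hΘt : 2 * (1 + (θ : ℝ≥0∞) ^ q) ≠ ∞ :=
    ENNReal.mul_ne_top (by simp) (ENNReal.add_ne_top.2
      ⟨by simp, ENNReal.rpow_ne_top_of_nonneg hq0.le ENNReal.coe_ne_top⟩)
  obtain ⟨t, ht⟩ := exists_isGeometricPartition ν h0 hΘ2 hΘt
  exact lintegral_condDensity_le_of_partition hU hq0 hq1 hr hv hν ht rfl hD H

theorem A3star_add_A4star_le {w : ℝ → ℝ≥0∞} (hU : IsRegularKernel θ U) (hq0 : 0 < q) (hq1 : q < 1)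
    (hr : r = q / (1 - q)) (hv : IsWeight v) (hw : IsWeight w) {C : ℝ≥0}
    (hC : HardyInequality 1 q U v w C) :
    A3star q U v w + A4star q U v w ≤ necConst q r θ * (C : ℝ≥0∞) ^ r := by
  have h1q : 0 < 1 - q := by linarith
  have hac := weightMeasure_absolutelyContinuous w
  have : NullSingletonClass (weightMeasure w) :=
    ⟨fun p => (hac.trans Measure.restrict_le_self.absolutelyContinuous) (by simp)⟩
  -- This converts D^{1+r} with D = C^q into C^r.
  have hqr : q * (1 + r) = r := by rw [hr]; field_simp; ring
  rw [A3star_add_A4star hU hq0 hq1 hr hw.1]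
  refine (lintegral_condDensity_le hU hq0 hq1 hr hv hac (weightMeasure_Iio_lt_top hw)
    (D := (C : ℝ≥0∞) ^ q) (ENNReal.rpow_ne_top_of_nonneg hq0.le ENNReal.coe_ne_top) ?_).trans
    (le_of_eq (by rw [← ENNReal.rpow_mul, hqr]))
  intro f hf
  have h1 := ENNReal.rpow_le_rpow (hC f hf) hq0.le
  rwa [weightedNorm_hardyOp hU hw.1, weightedNorm_one, ← ENNReal.rpow_mul,
    one_div_mul_cancel hq0.ne', ENNReal.rpow_one, ENNReal.mul_rpow_of_nonneg _ _ hq0.le] at h1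

theorem A3star_add_A4star_le_hardyConst {w : ℝ → ℝ≥0∞} (hU : IsRegularKernel θ U) (hq0 : 0 < q)
    (hq1 : q < 1) (hr : r = q / (1 - q)) (hv : IsWeight v) (hw : IsWeight w) {K : ℝ≥0∞}
    (hK0 : K ≠ 0) (hK : K ≠ ∞) (hle : necConst q r θ ≤ K) :
    A3star q U v w + A4star q U v w ≤ K * hardyConst 1 q U v w ^ r := by
  have h1q : 0 < 1 - q := by linarith
  have hr0 : 0 < r := by rw [hr]; positivity
  set A := A3star q U v w + A4star q U v w with hA
  have h1 : (A / K) ^ (1 / r) ≤ hardyConst 1 q U v w := by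
    refine le_iInf₂ fun C hC => ?_
    have h2 : A / K ≤ (C : ℝ≥0∞) ^ r := by
      rw [ENNReal.div_le_iff_le_mul (Or.inl hK0) (Or.inl hK), mul_comm]
      exact (A3star_add_A4star_le hU hq0 hq1 hr hv hw hC).trans (by gcongr)
    calc (A / K) ^ (1 / r) ≤ ((C : ℝ≥0∞) ^ r) ^ (1 / r) :=
          ENNReal.rpow_le_rpow h2 (by positivity)
      _ = C := by rw [← ENNReal.rpow_mul, mul_one_div_cancel hr0.ne', ENNReal.rpow_one]
  have h3 := ENNReal.rpow_le_rpow h1 hr0.le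
  rw [← ENNReal.rpow_mul, one_div_mul_cancel hr0.ne', ENNReal.rpow_one,
    ENNReal.div_le_iff_le_mul (Or.inl hK0) (Or.inl hK), mul_comm] at h3
  exact h3

end Necessity

/-! ### The equivalence and the two-sided estimate -/

theorem mainTheorem4 (q : ℝ) (hq0 : 0 < q) (hq1 : q < 1) (θ : ℝ≥0) (hθ : 0 < θ) :
    ∃ K : ℝ≥0, 0 < K ∧
      ∀ (U : ℝ → ℝ → ℝ≥0) (v w : ℝ → ℝ≥0∞),
        IsRegularKernel θ U → IsWeight v → IsWeight w →
          ((∃ C : ℝ≥0, 0 < C ∧ HardyInequality 1 q U v w C) ↔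
            A3star q U v w < ∞ ∧ A4star q U v w < ∞) ∧
          hardyConst 1 q U v w ^ (-conjExp q) ≤ K * (A3star q U v w + A4star q U v w) ∧
          A3star q U v w + A4star q U v w ≤ K * hardyConst 1 q U v w ^ (-conjExp q) := by
  have h1q : 0 < 1 - q := by linarith
  obtain ⟨r, hr⟩ : ∃ r, r = q / (1 - q) := ⟨_, rfl⟩
  have hr0 : 0 < r := by rw [hr]; positivity
  have hq' : -conjExp q = r := by rw [conjExp, hr, ← neg_sub 1 q, div_neg, neg_neg]
  obtain ⟨hS0, hS⟩ := suffConst_ne (q := q) (r := r) hθ hq0 hr0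
  set K : ℝ≥0∞ := suffConst q r θ * 3 + necConst q r θ with hK
  have hKt : K ≠ ∞ := ENNReal.add_ne_top.2
    ⟨ENNReal.mul_ne_top hS (by simp), necConst_ne_top hq0 hr0⟩
  have hK0 : K ≠ 0 := by simp [hK, hS0]
  refine ⟨K.toNNReal, ENNReal.toNNReal_pos hK0 hKt, fun U v w hU hv hw => ?_⟩
  rw [ENNReal.coe_toNNReal hKt, hq']
  refine ⟨⟨?_, ?_⟩, ?_, ?_⟩
  · rintro ⟨C, -, hC⟩
    have h := A3star_add_A4star_le hU hq0 hq1 hr hv hw hC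
    have h2 := lt_of_le_of_lt h (ENNReal.mul_lt_top (necConst_ne_top hq0 hr0).lt_top
      (ENNReal.rpow_lt_top_of_nonneg hr0.le ENNReal.coe_ne_top))
    exact ENNReal.add_lt_top.1 h2
  · rintro ⟨h3, h4⟩
    have hA : 3 * (A3star q U v w + A4star q U v w) ≠ ∞ :=
      ENNReal.mul_ne_top (by simp) (ENNReal.add_ne_top.2 ⟨h3.ne, h4.ne⟩)
    have hlt : 3 * (A3star q U v w + A4star q U v w) <
        3 * (A3star q U v w + A4star q U v w) + 1 := ENNReal.lt_add_right hA one_ne_zero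
    have hAt : 3 * (A3star q U v w + A4star q U v w) + 1 ≠ ∞ :=
      ENNReal.add_ne_top.2 ⟨hA, by simp⟩
    refine ⟨_, ?_, hardyInequality_of_lt hU hθ hq0 hq1 hr hv hw hlt hAt⟩
    refine ENNReal.toNNReal_pos ?_ (ENNReal.rpow_ne_top_of_nonneg (by positivity)
      (ENNReal.mul_ne_top hS hAt))
    rw [Ne, ENNReal.rpow_eq_zero_iff_of_pos (by positivity)]
    exact mul_ne_zero hS0 (by simp)
  · refine (hardyConst_rpow_le hU hθ hq0 hq1 hr hv hw).trans ?_
    gcongr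
    exact le_self_add
  · exact A3star_add_A4star_le_hardyConst hU hq0 hq1 hr hv hw hK0 hKt le_add_self
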